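/- Let $m\ge 0$ be an integer, let $(t,x)\mapsto v_t(x)$ be a Borel vector field on $[0,\infty)\times\mathbb R^m$ with values in $\mathbb R^m$, and let $(\mu_t)_{t\ge 0}$ be a narrowly continuous curve of Borel probability measures on $\mathbb R^m$ with $\mu_0=\mu$ that solves the continuity equation $\partial_t\mu_t=-\nabla\cdot(\mu_t v_t)$ in $(0,\infty)\times\mathbb R^m$ in the sense of distributions, i.e. $$\int_0^\infty\int_{\mathbb R^m}\big(\partial_t\varphi(t,x)+\nabla_x\varphi(t,x)\cdot v_t(x)\big)\,d\mu_t(x)\,dt=0\qquad\text{for all }\varphi\in C_c^\infty((0,\infty)\times\mathbb R^m).$$ Assume that 1. $\|v_t\|_{L^1(\mu_t,\mathbb R^m)}\in L^1_{\mathrm{loc}}([0,\infty))$; 2. for every compact $K\subset\mathbb R^m$ there are functions $B_t=B_t(K)\ge 0$ and $L_t=L_t(K)\ge 0$ with $B_t+L_t\in L^1_{\mathrm{loc}}([0,\infty))$ such that, for almost every $t\ge 0$, $|v_t|\le B_t$ on $K$ and $v_t$ is Lipschitz on $K$ with constant $L_t$. Then there is a map $X:[0,\infty)\times\mathbb R^m\to\mathbb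 R^m$, $(t,x)\mapsto X_t(x)$, such that for $\mu$-almost every $x$ the curve $t\mapsto X_t(x)$ is the unique solution on $[0,\infty)$ of the McKean–Vlasov equation $$\frac{d}{dt}X_t(x)=v_t(X_t(x)),\qquad X_0(x)=x$$ (a solution being a locally absolutely continuous curve that satisfies the equation for almost every $t$), and such that, for every $t\ge 0$, $X_t$ is $\mu$-measurable and $$\mu_t=(X_t)_\#\mu .$$ -/

import Mathlib

open MeasureTheory Set
open scoped ContDiff NNReal

/-- Joint local Lipschitz condition on a time-dependent vector field: on every compact set `K`
of the space, for almost every time `t ≥ 0`, `v t` is bounded by `B t` and Lipschitz with constant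
`L t`, where `B + L` is in `L¹_loc([0,∞))`. The functions `B` and `L` may depend on `K`. -/
def HasLocLipBounds {m : ℕ} (v : ℝ → EuclideanSpace ℝ (Fin m) → EuclideanSpace ℝ (Fin m)) :
    Prop :=
  ∀ K : Set (EuclideanSpace ℝ (Fin m)), IsCompact K →
    ∃ B L : ℝ → ℝ≥0,
      LocallyIntegrableOn (fun t => (B t : ℝ) + (L t : ℝ)) (Ici 0) volume ∧
      ∀ᵐ t ∂(volume.restrict (Ici (0 : ℝ))),
        (∀ x ∈ K, ‖v t x‖ ≤ B t) ∧ LipschitzOnWith (L t) (v t) K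

/-- The function `t ↦ ‖v t‖_{L¹(μ t)}` is in `L¹_loc([0,∞))`. -/
def HasLocIntegrableL1Norm {m : ℕ}
    (v : ℝ → EuclideanSpace ℝ (Fin m) → EuclideanSpace ℝ (Fin m))
    (μ : ℝ → ProbabilityMeasure (EuclideanSpace ℝ (Fin m))) : Prop :=
  ∀ T : ℝ, ∫⁻ t in Icc 0 T, eLpNorm (v t) 1 (μ t : Measure (EuclideanSpace ℝ (Fin m))) < ⊤

/-- `μ` is a narrowly continuous curve of probability measures on `[0,∞)`, starting at `μ₀`, that
solves `∂ₜ μ = -∇ · (μ v)` on `(0,∞) × ℝᵐ` in the sense of distributions. The topology on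
`ProbabilityMeasure` is that of narrow (weak) convergence. -/
structure IsContinuityEqSolution {m : ℕ}
    (v : ℝ → EuclideanSpace ℝ (Fin m) → EuclideanSpace ℝ (Fin m))
    (μ₀ : ProbabilityMeasure (EuclideanSpace ℝ (Fin m)))
    (μ : ℝ → ProbabilityMeasure (EuclideanSpace ℝ (Fin m))) : Prop where
  continuousOn : ContinuousOn μ (Ici 0)
  initial : μ 0 = μ₀
  weak : ∀ φ : ℝ × EuclideanSpace ℝ (Fin m) → ℝ,
    ContDiff ℝ ∞ φ → HasCompactSupport φ → tsupport φ ⊆ Ioi 0 ×ˢ univ →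
    ∫ t in Ioi (0 : ℝ),
      (∫ x, (deriv (fun s => φ (s, x)) t + fderiv ℝ (fun y => φ (t, y)) x (v t x))
        ∂(μ t : Measure (EuclideanSpace ℝ (Fin m)))) = 0

/-- `γ` is a global (Carathéodory) solution of `γ' = v t γ`, `γ 0 = x` on `[0,∞)`: it is locally
absolutely continuous and satisfies the equation at almost every time. -/
structure IsODESolution {m : ℕ}
    (v : ℝ → EuclideanSpace ℝ (Fin m) → EuclideanSpace ℝ (Fin m))
    (x : EuclideanSpace ℝ (Fin m)) (γ : ℝ → EuclideanSpace ℝ (Fin m)) : Prop where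
  initial : γ 0 = x
  absCont : ∀ T : ℝ, 0 ≤ T → AbsolutelyContinuousOnInterval γ 0 T
  hasDerivAt : ∀ᵐ t ∂(volume.restrict (Ioi (0 : ℝ))), HasDerivAt γ (v t (γ t)) t

/-- `X` is the flow of `d/dt X t x = v t (X t x)`, `X 0 x = x`, for `μ₀`-almost every `x`: the
trajectory `t ↦ X t x` is the unique solution on `[0,∞)` starting at `x`. -/
def IsFlow {m : ℕ}
    (v : ℝ → EuclideanSpace ℝ (Fin m) → EuclideanSpace ℝ (Fin m))
    (μ₀ : ProbabilityMeasure (EuclideanSpace ℝ (Fin m)))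
    (X : ℝ → EuclideanSpace ℝ (Fin m) → EuclideanSpace ℝ (Fin m)) : Prop :=
  ∀ᵐ x ∂(μ₀ : Measure (EuclideanSpace ℝ (Fin m))),
    IsODESolution v x (fun t => X t x) ∧
    ∀ γ : ℝ → EuclideanSpace ℝ (Fin m), IsODESolution v x γ → ∀ t : ℝ, 0 ≤ t → γ t = X t x

/-!
The solution `μ` of the continuity equation is compared with the images of `μ 0` under the flows
of truncated vector fields, and then it prevents the trajectories from escaping to infinity.

Multiplying `v` by smooth cutoffs gives globally Lipschitz Carathéodory fields `w n` that agree
with `v` on the ball of radius `2 * (n + 1)` up to time `n` (`exists_lipField_eq`). Their flows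
`Exhaustion.y` are constructed by Picard iteration, in a norm with a weight in time that turns the
integrable Lipschitz constant into a contraction constant.

*Comparison* (`WeakSolution.abs_integral_sub_integral_flow_le`). Let `ψ` be bounded and
Lipschitz, and let `u s = ψ ∘ flow s t`, where `flow` is the flow of `w n`. Formally `u` solves
the backward transport equation, so that `s ↦ ∫ u s * χ ∂(μ s)` would change only where
the cutoff `χ` varies. Since `u s` is merely Lipschitz, it is mollified in space. Over a short time
interval the mollified function is transported along the displacement whose velocity is frozen at its
starting point, up to errors that are quadratic in time integrals over the interval, or that have the
mollification radius as a factor. The quadratic errors disappear in a subdivision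
(`abs_sub_le_integral_of_quadratic_error`) and the other ones when the radius tends to `0`. What
remains is the error caused by `χ`, which is at most `sup |ψ| * sup |∇χ|` times the integral of
the `L¹` norms of the velocity, and which tends to `0` as the cutoff is spread out. Hence
`(μ 0).map (hX.y n t)` converges narrowly to `μ t` as `n` grows (`Exhaustion.tendsto_map_y`).

*No explosion* (`Exhaustion.ae_exists_mem_stay`). The part of `μ 0` whose trajectories have stayed
in the ball of radius `n + 1` up to time `t` is not affected by further truncations, so by the
portmanteau theorem its image at time `t` is at most `μ t` (`Exhaustion.map_restrict_stay_le`).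
Therefore the mean length of the trajectories of `w n`, measured up to the exit from this ball, is
at most the integral of the `L¹` norms of `v`, uniformly in `n`. A trajectory from `x` that leaves
the ball has length at least `n + 1 - ‖x‖`, so by Fatou's lemma almost every trajectory stays in
some ball up to a given time.

The truncated flows are thus eventually constant in `n` along almost every trajectory. Their limit
is the flow of `v`, and its image measure at time `t` is the narrow limit `μ t`. A solution is
bounded on compact time intervals, so it is also an integral curve of the `w n` with large `n`,
and uniqueness follows from Gronwall's inequality for these fields.
-/

open Filter Topology

namespace ContinuityEq

/-! ### Absolutely continuous functions and integral inequalities -/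

/-- A function whose increments are dominated by those of an absolutely continuous function is
absolutely continuous. -/
theorem absolutelyContinuousOnInterval_of_dist_le {X Y : Type*} [PseudoMetricSpace X]
    [PseudoMetricSpace Y] {f : ℝ → X} {F : ℝ → Y} {a b K : ℝ}
    (hF : AbsolutelyContinuousOnInterval F a b)
    (h : ∀ x ∈ uIcc a b, ∀ y ∈ uIcc a b, dist (f x) (f y) ≤ K * dist (F x) (F y)) :
    AbsolutelyContinuousOnInterval f a b := by
  have hF' : Tendsto (fun E : ℕ × (ℕ → ℝ × ℝ) =>
      K * ∑ i ∈ Finset.range E.1, dist (F (E.2 i).1) (F (E.2 i).2))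
      (AbsolutelyContinuousOnInterval.totalLengthFilter ⊓
        𝓟 (AbsolutelyContinuousOnInterval.disjWithin a b)) (𝓝 0) := by
    simpa using! Tendsto.const_mul K hF
  refine squeeze_zero' (Eventually.of_forall fun E => Finset.sum_nonneg fun _ _ => dist_nonneg)
    ?_ hF'
  have hE : ∀ᶠ E in (AbsolutelyContinuousOnInterval.totalLengthFilter ⊓
      𝓟 (AbsolutelyContinuousOnInterval.disjWithin a b)),
      E ∈ AbsolutelyContinuousOnInterval.disjWithin a b :=
    eventually_inf_principal.mpr (by simp)
  filter_upwards [hE] with E hE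
  rw [Finset.mul_sum]
  exact Finset.sum_le_sum fun i hi => h _ (hE.1 i hi).1 _ (hE.1 i hi).2

/-- The primitive of an integrable function that vanishes at `-∞`. -/
noncomputable def prim (g : ℝ → ℝ) (t : ℝ) : ℝ := ∫ q in Iic t, g q

section Prim

variable {g : ℝ → ℝ}

theorem prim_sub_prim (hg : Integrable g) (s t : ℝ) :
    prim g t - prim g s = ∫ r in s..t, g r :=
  intervalIntegral.integral_Iic_sub_Iic hg.integrableOn hg.integrableOn

theorem continuous_prim (hg : Integrable g) : Continuous (prim g) := by
  have h : prim g = fun t => prim g 0 + ∫ r in (0 : ℝ)..t, g r := by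
    funext t
    rw [← prim_sub_prim hg]
    ring
  rw [h]
  exact continuous_const.add
    (intervalIntegral.continuous_primitive (fun _ _ => hg.intervalIntegrable) 0)

theorem prim_nonneg (hg0 : ∀ t, 0 ≤ g t) (t : ℝ) : 0 ≤ prim g t :=
  integral_nonneg fun r => hg0 r

theorem prim_le (hg : Integrable g) (hg0 : ∀ t, 0 ≤ g t) (t : ℝ) : prim g t ≤ ∫ r, g r :=
  setIntegral_le_integral hg (Eventually.of_forall hg0)

theorem intervalIntegral_le_integral (hg : Integrable g) (hg0 : ∀ t, 0 ≤ g t) (s t : ℝ) :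
    ∫ r in s..t, g r ≤ ∫ r, g r := by
  rw [← prim_sub_prim hg]
  linarith [prim_le hg hg0 t, prim_nonneg hg0 s]

theorem absolutelyContinuousOnInterval_prim (hg : Integrable g) (s t : ℝ) :
    AbsolutelyContinuousOnInterval (prim g) s t := by
  refine absolutelyContinuousOnInterval_of_dist_le (K := 1)
    ((hg.intervalIntegrable (a := s) (b := t)).absolutelyContinuousOnInterval_intervalIntegral
      (c := s) left_mem_uIcc) fun x _ y _ => ?_
  rw [← prim_sub_prim hg, ← prim_sub_prim hg, Real.dist_eq, Real.dist_eq, one_mul]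
  simp

theorem ae_hasDerivAt_prim (hg : Integrable g) : ∀ᵐ t, HasDerivAt (prim g) (g t) t := by
  filter_upwards [LocallyIntegrable.ae_hasDerivAt_integral hg.locallyIntegrable] with t ht
  refine ((ht 0).const_add (prim g 0)).congr_of_eventuallyEq (Eventually.of_forall fun r => ?_)
  simp [← prim_sub_prim hg]

/-- The weight `exp (2 * prim g)` makes the Picard operator a contraction with constant `1/2`. -/
theorem integral_mul_exp_le (hg : Integrable g) (s t : ℝ) :
    ∫ r in s..t, g r * Real.exp (2 * prim g r) ≤ Real.exp (2 * prim g t) / 2 := by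
  have hac : AbsolutelyContinuousOnInterval (fun r => Real.exp (2 * prim g r)) s t := by
    obtain ⟨C, hC⟩ := (isCompact_uIcc (a := s) (b := t)).exists_bound_of_continuousOn
      (continuous_prim hg).continuousOn
    have key : ∀ a b : ℝ, a ≤ b → b ≤ 2 * C →
        Real.exp b - Real.exp a ≤ Real.exp (2 * C) * (b - a) := fun a b hab hb => by
      have h1 : Real.exp a = Real.exp b * Real.exp (a - b) := by
        rw [← Real.exp_add]; ring_nf
      have h2 := Real.add_one_le_exp (a - b)
      have h3 : Real.exp b ≤ Real.exp (2 * C) := Real.exp_le_exp.mpr hb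
      have h4 := Real.exp_pos b
      nlinarith
    refine absolutelyContinuousOnInterval_of_dist_le (K := 2 * Real.exp (2 * C))
      (absolutelyContinuousOnInterval_prim hg s t) fun x hx y hy => ?_
    have hx' := (abs_le.mp (hC x hx)).2
    have hy' := (abs_le.mp (hC y hy)).2
    rw [Real.dist_eq, Real.dist_eq]
    rcases le_total (prim g x) (prim g y) with h | h
    · rw [abs_sub_comm, abs_of_nonneg (by simpa using h), abs_sub_comm, abs_of_nonneg (by linarith)]
      linarith [key (2 * prim g x) (2 * prim g y) (by linarith) (by linarith)]
    · rw [abs_of_nonneg (by simpa using h), abs_of_nonneg (by linarith)]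
      linarith [key (2 * prim g y) (2 * prim g x) (by linarith) (by linarith)]
  have h1 := hac.integral_deriv_eq_sub
  have h2 : ∫ r in s..t, deriv (fun r => Real.exp (2 * prim g r)) r
      = ∫ r in s..t, 2 * (g r * Real.exp (2 * prim g r)) := by
    refine intervalIntegral.integral_congr_ae ?_
    filter_upwards [ae_hasDerivAt_prim hg] with r hr _
    rw [((hr.const_mul 2).exp).deriv]
    ring
  rw [h2, intervalIntegral.integral_const_mul] at h1
  linarith [Real.exp_pos (2 * prim g s)]

/-- Integral form of Gronwall's inequality for an integrable rate. The constant is not optimal. -/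
theorem le_of_le_add_integral_mul (hg : Integrable g) (hg0 : ∀ t, 0 ≤ g t) {u : ℝ → ℝ}
    {s t a : ℝ} (hst : s ≤ t) (hu : ContinuousOn u (Icc s t)) (hu0 : ∀ r ∈ Icc s t, 0 ≤ u r)
    (ha : 0 ≤ a) (h : ∀ r ∈ Icc s t, u r ≤ a + ∫ q in s..r, g q * u q) :
    u t ≤ 2 * Real.exp (2 * ∫ r, g r) * a := by
  have hP := continuous_prim hg
  obtain ⟨r₀, hr₀, hmax⟩ := isCompact_Icc.exists_isMaxOn (nonempty_Icc.mpr hst)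
    (f := fun r => u r * Real.exp (-(2 * prim g r))) (hu.mul (by fun_prop))
  set S := u r₀ * Real.exp (-(2 * prim g r₀)) with hS
  have hle : ∀ r ∈ Icc s t, u r ≤ S * Real.exp (2 * prim g r) := fun r hr => by
    have h1 : u r * Real.exp (-(2 * prim g r)) ≤ S := hmax hr
    rw [Real.exp_neg, ← div_eq_mul_inv, div_le_iff₀ (Real.exp_pos _)] at h1
    exact h1
  have hS0 : 0 ≤ S := mul_nonneg (hu0 r₀ hr₀) (Real.exp_pos _).le
  have h1 : ∫ q in s..r₀, g q * u q ≤ S * (Real.exp (2 * prim g r₀) / 2) := by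
    calc ∫ q in s..r₀, g q * u q
        ≤ ∫ q in s..r₀, S * (g q * Real.exp (2 * prim g q)) := by
          refine intervalIntegral.integral_mono_on hr₀.1 ?_ ?_ fun q hq => ?_
          · refine hg.intervalIntegrable.mul_continuousOn (hu.mono ?_)
            rw [uIcc_of_le hr₀.1]
            exact Icc_subset_Icc_right hr₀.2
          · exact (hg.intervalIntegrable.mul_continuousOn (by fun_prop)).const_mul S
          · have := mul_le_mul_of_nonneg_left (hle q ⟨hq.1, hq.2.trans hr₀.2⟩) (hg0 q)
            linarith
      _ ≤ _ := by
          rw [intervalIntegral.integral_const_mul]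
          exact mul_le_mul_of_nonneg_left (integral_mul_exp_le hg s r₀) hS0
  have h2 : S ≤ a + S / 2 := by
    have h3 := (h r₀ hr₀).trans (add_le_add_right h1 a)
    have h4 : Real.exp (-(2 * prim g r₀)) ≤ 1 :=
      Real.exp_le_one_iff.mpr (by linarith [prim_nonneg hg0 r₀])
    have h5 : Real.exp (2 * prim g r₀) * Real.exp (-(2 * prim g r₀)) = 1 := by
      rw [← Real.exp_add]; simp
    have h6 : S ≤ (a + S * (Real.exp (2 * prim g r₀) / 2)) * Real.exp (-(2 * prim g r₀)) :=
      mul_le_mul_of_nonneg_right h3 (Real.exp_pos _).le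
    have h7 : (a + S * (Real.exp (2 * prim g r₀) / 2)) * Real.exp (-(2 * prim g r₀))
        = a * Real.exp (-(2 * prim g r₀)) + S / 2 := by
      linear_combination (S / 2) * h5
    nlinarith
  have h8 : Real.exp (2 * prim g t) ≤ Real.exp (2 * ∫ r, g r) :=
    Real.exp_le_exp.mpr (by linarith [prim_le hg hg0 t])
  calc u t ≤ S * Real.exp (2 * prim g t) := hle t ⟨hst, le_rfl⟩
    _ ≤ 2 * a * Real.exp (2 * ∫ r, g r) :=
        mul_le_mul (by linarith) h8 (Real.exp_pos _).le (by linarith)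
    _ = _ := by ring

end Prim

/-- If the increments of `F` are bounded by the integral of `e` up to an error that is quadratic in
the integral of `h`, then summing over finer and finer partitions removes the error. -/
theorem abs_sub_le_integral_of_quadratic_error {F e h : ℝ → ℝ} {a b C : ℝ} (hab : a ≤ b)
    (he : IntervalIntegrable e volume a b) (hh : IntervalIntegrable h volume a b)
    (hh0 : ∀ t, 0 ≤ h t) (hC : 0 ≤ C)
    (hF : ∀ s s', a ≤ s → s ≤ s' → s' ≤ b →
      |F s' - F s| ≤ (∫ r in s..s', e r) + C * (∫ r in s..s', h r) ^ 2) :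
    |F b - F a| ≤ ∫ r in a..b, e r := by
  have hint : ∀ {f : ℝ → ℝ}, IntervalIntegrable f volume a b → ∀ {s s'}, a ≤ s → s ≤ s' →
      s' ≤ b → IntervalIntegrable f volume s s' := fun hf s s' h1 h2 h3 =>
    hf.mono_set (by rw [uIcc_of_le hab, uIcc_of_le h2]; exact Icc_subset_Icc h1 h3)
  have hI0 : 0 ≤ ∫ r in a..b, h r := intervalIntegral.integral_nonneg hab fun r _ => hh0 r
  refine le_of_forall_pos_le_add fun η' hη' => ?_
  obtain ⟨η, hη, hηη⟩ : ∃ η > 0, C * η * (∫ r in a..b, h r) ≤ η' := by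
    refine ⟨η' / (C * (∫ r in a..b, h r) + 1), by positivity, ?_⟩
    rw [mul_div_assoc', div_mul_eq_mul_div, div_le_iff₀ (by positivity)]
    nlinarith
  have huc : UniformContinuousOn (fun t => ∫ r in a..t, h r) (Icc a b) := by
    refine isCompact_Icc.uniformContinuousOn_of_continuous ?_
    rw [← uIcc_of_le hab]
    exact intervalIntegral.continuousOn_primitive_interval' hh left_mem_uIcc
  obtain ⟨δ, hδ, hδη⟩ := Metric.uniformContinuousOn_iff.mp huc η hη
  obtain ⟨N, hN⟩ := exists_nat_gt ((b - a) / δ)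
  have hN0 : (0 : ℝ) < N := lt_of_le_of_lt (by have := sub_nonneg.mpr hab; positivity) hN
  set d := (b - a) / N with hd
  have hd0 : 0 ≤ d := div_nonneg (sub_nonneg.mpr hab) hN0.le
  have hdδ : d < δ := by
    rw [hd, div_lt_iff₀ hN0]
    rw [div_lt_iff₀ hδ] at hN
    linarith
  have hdN : N * d = b - a := by rw [hd]; field_simp
  have ind : ∀ i : ℕ, i ≤ N → |F (a + i * d) - F a| ≤
      (∫ r in a..(a + i * d), e r) + C * η * ∫ r in a..(a + i * d), h r := by
    intro i
    induction i with
    | zero => simp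
    | succ i ih =>
      intro hi
      have ih := ih (by omega)
      have hi' : ((i + 1 : ℕ) : ℝ) ≤ N := by exact_mod_cast hi
      push_cast at hi' ⊢
      set s := a + i * d with hs
      have hs' : a + (i + 1) * d = s + d := by rw [hs]; ring
      rw [hs']
      have h1 : a ≤ s := by rw [hs]; have : 0 ≤ (i : ℝ) * d := by positivity
                            linarith
      have h2 : s + d ≤ b := by rw [← hs']; nlinarith
      have h3 : s ≤ s + d := by linarith
      have ee := intervalIntegral.integral_add_adjacent_intervals (hint he le_rfl h1 (by linarith))
        (hint he h1 h3 h2)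
      have hhh := intervalIntegral.integral_add_adjacent_intervals
        (hint hh le_rfl h1 (by linarith)) (hint hh h1 h3 h2)
      have h4 := hF s (s + d) h1 h3 h2
      have h5 : 0 ≤ ∫ r in s..(s + d), h r := intervalIntegral.integral_nonneg h3 fun r _ => hh0 r
      have h6 : ∫ r in s..(s + d), h r ≤ η := by
        have := hδη (s + d) ⟨by linarith, h2⟩ s ⟨h1, by linarith⟩
          (by rw [Real.dist_eq]; simpa [abs_of_nonneg hd0] using hdδ)
        rw [Real.dist_eq, ← hhh, add_sub_cancel_left, abs_of_nonneg h5] at this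
        exact this.le
      have h7 : C * (∫ r in s..(s + d), h r) ^ 2 ≤ C * η * ∫ r in s..(s + d), h r := by
        rw [sq, mul_assoc]
        exact mul_le_mul_of_nonneg_left (mul_le_mul_of_nonneg_right h6 h5) hC
      have h8 := abs_sub_le (F (s + d)) (F s) (F a)
      rw [← ee, ← hhh]
      linarith
  have := ind N le_rfl
  rw [hdN, add_sub_cancel] at this
  linarith

/-! ### The flow of a globally Lipschitz Carathéodory field -/

section Flow

set_option linter.unusedSectionVars false

variable {E : Type*} [NormedAddCommGroup E] [NormedSpace ℝ E] [MeasurableSpace E]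

/-- A Borel time-dependent vector field that is bounded by `g t` and Lipschitz with constant `g t`
on the whole space, at every time `t`, for an integrable function `g`. -/
structure LipField (w : ℝ → E → E) (g : ℝ → ℝ) : Prop where
  measurable : Measurable (fun p : ℝ × E => w p.1 p.2)
  integrable : Integrable g
  norm_le : ∀ t x, ‖w t x‖ ≤ g t
  lip : ∀ t x y, ‖w t x - w t y‖ ≤ g t * ‖x - y‖

namespace LipField

variable {w : ℝ → E → E} {g : ℝ → ℝ}

theorem nonneg (hw : LipField w g) (t : ℝ) : 0 ≤ g t := (norm_nonneg _).trans (hw.norm_le t 0)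

variable [BorelSpace E] [SecondCountableTopology E]

theorem integrableOn_comp (hw : LipField w g) {γ : ℝ → E} {S : Set ℝ} (hS : MeasurableSet S)
    (hγ : ContinuousOn γ S) : IntegrableOn (fun r => w r (γ r)) S := by
  refine hw.integrable.integrableOn.mono' ?_ (Eventually.of_forall fun r => hw.norm_le r _)
  exact (hw.measurable.comp_aemeasurable
    (aemeasurable_id.prodMk (hγ.aemeasurable hS))).aestronglyMeasurable

theorem intervalIntegrable_comp (hw : LipField w g) {γ : ℝ → E} {s t : ℝ}
    (hγ : ContinuousOn γ (uIcc s t)) : IntervalIntegrable (fun r => w r (γ r)) volume s t :=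
  (intervalIntegrable_iff_integrableOn_Icc_of_le min_le_max).mpr
    (hw.integrableOn_comp measurableSet_Icc hγ) |>.mono_set (by rw [uIcc_of_le min_le_max]; rfl)

theorem norm_integral_le (hw : LipField w g) (γ : ℝ → E) {s t : ℝ} (hst : s ≤ t) :
    ‖∫ r in s..t, w r (γ r)‖ ≤ ∫ r in s..t, g r :=
  intervalIntegral.norm_integral_le_of_norm_le hst
    (Eventually.of_forall fun r _ => hw.norm_le r _) hw.integrable.intervalIntegrable

theorem norm_sub_le_of_integral_eq (hw : LipField w g) {γ γ' : ℝ → E} {s t : ℝ} {x x' : E}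
    (hst : s ≤ t)
    (hγ : ContinuousOn γ (Icc s t)) (hγ' : ContinuousOn γ' (Icc s t))
    (h : ∀ r ∈ Icc s t, γ r = x + ∫ q in s..r, w q (γ q))
    (h' : ∀ r ∈ Icc s t, γ' r = x' + ∫ q in s..r, w q (γ' q)) :
    ‖γ t - γ' t‖ ≤ 2 * Real.exp (2 * ∫ r, g r) * ‖x - x'‖ := by
  refine le_of_le_add_integral_mul hw.integrable hw.nonneg (u := fun r => ‖γ r - γ' r‖) hst
    (hγ.sub hγ').norm (fun r _ => norm_nonneg _) (norm_nonneg _) fun r hr => ?_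
  have hsub : uIcc s r ⊆ Icc s t := by
    rw [uIcc_of_le hr.1]; exact Icc_subset_Icc_right hr.2
  have h1 := hw.intervalIntegrable_comp (hγ.mono hsub)
  have h2 := hw.intervalIntegrable_comp (hγ'.mono hsub)
  have h3 : γ r - γ' r = (x - x') + ∫ q in s..r, (w q (γ q) - w q (γ' q)) := by
    rw [intervalIntegral.integral_sub h1 h2, h r hr, h' r hr]
    abel
  simp only [h3]
  refine (norm_add_le _ _).trans (add_le_add_right ?_ _)
  refine intervalIntegral.norm_integral_le_of_norm_le hr.1
    (Eventually.of_forall fun q _ => hw.lip q _ _) ?_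
  exact hw.integrable.intervalIntegrable.mul_continuousOn ((hγ.sub hγ').norm.mono hsub)

/-- Integral curves are fixed points of the Picard operator, which in terms of
`t ↦ exp (-2 * prim g t) • γ t` is a contraction of the space of bounded continuous functions. -/
theorem exists_integralCurve [CompleteSpace E] (hw : LipField w g) (s : ℝ) (x : E) :
    ∃ γ : ℝ → E, Continuous γ ∧ ∀ t, γ t = x + ∫ r in s..max s t, w r (γ r) := by
  have hP := continuous_prim hw.integrable
  have hint : ∀ (β : ℝ → E), Continuous β → ∀ a b : ℝ,
      IntervalIntegrable (fun r => w r (Real.exp (2 * prim g r) • β r)) volume a b :=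
    fun β hβ a b => hw.intervalIntegrable_comp
      (γ := fun r => Real.exp (2 * prim g r) • β r) (by fun_prop)
  let Q₀ : (BoundedContinuousFunction ℝ E) → ℝ → E := fun β t =>
    Real.exp (-(2 * prim g t)) • (x + ∫ r in s..max s t, w r (Real.exp (2 * prim g r) • β r))
  have hcont : ∀ β, Continuous (Q₀ β) := fun β => by
    have h1 : Continuous fun t => ∫ r in s..t, w r (Real.exp (2 * prim g r) • β r) :=
      intervalIntegral.continuous_primitive (hint β β.continuous) s
    have h2 : Continuous fun t => ∫ r in s..max s t, w r (Real.exp (2 * prim g r) • β r) :=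
      h1.comp (continuous_const.max continuous_id)
    exact Continuous.smul (by fun_prop) (continuous_const.add h2)
  have hexp : ∀ t, Real.exp (-(2 * prim g t)) ≤ 1 := fun t =>
    Real.exp_le_one_iff.mpr (by linarith [prim_nonneg hw.nonneg t])
  have hbd : ∀ β t, ‖Q₀ β t‖ ≤ ‖x‖ + ∫ r, g r := fun β t => by
    rw [norm_smul, Real.norm_eq_abs, abs_of_pos (Real.exp_pos _)]
    refine (mul_le_of_le_one_left (norm_nonneg _) (hexp t)).trans ((norm_add_le _ _).trans ?_)
    exact add_le_add_right ((hw.norm_integral_le _ (le_max_left _ _)).trans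
      (intervalIntegral_le_integral hw.integrable hw.nonneg _ _)) _
  let Q : (BoundedContinuousFunction ℝ E) → (BoundedContinuousFunction ℝ E) := fun β =>
    BoundedContinuousFunction.ofNormedAddCommGroup (Q₀ β) (hcont β) _ (hbd β)
  have hQ : ContractingWith (1 / 2) Q := by
    refine ⟨by rw [← NNReal.coe_lt_coe]; norm_num, LipschitzWith.of_dist_le_mul fun β β' => ?_⟩
    refine (BoundedContinuousFunction.dist_le (by positivity)).mpr fun t => ?_
    change dist (Q₀ β t) (Q₀ β' t) ≤ _
    have h1 : Q₀ β t - Q₀ β' t = Real.exp (-(2 * prim g t)) • ∫ r in s..max s t,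
        (w r (Real.exp (2 * prim g r) • β r) - w r (Real.exp (2 * prim g r) • β' r)) := by
      rw [intervalIntegral.integral_sub (hint β β.continuous _ _) (hint β' β'.continuous _ _),
        ← smul_sub]
      congr 1
      abel
    have h2 : ‖∫ r in s..max s t,
        (w r (Real.exp (2 * prim g r) • β r) - w r (Real.exp (2 * prim g r) • β' r))‖
        ≤ dist β β' * (Real.exp (2 * prim g (max s t)) / 2) := by
      calc _ ≤ ∫ r in s..max s t, dist β β' * (g r * Real.exp (2 * prim g r)) := by
            refine intervalIntegral.norm_integral_le_of_norm_le (le_max_left _ _)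
              (Eventually.of_forall fun r _ => (hw.lip r _ _).trans ?_)
              ((hw.integrable.intervalIntegrable.mul_continuousOn (by fun_prop)).const_mul _)
            rw [← smul_sub, norm_smul, Real.norm_eq_abs, abs_of_pos (Real.exp_pos _),
              ← dist_eq_norm]
            have h3 := mul_le_mul_of_nonneg_left (BoundedContinuousFunction.dist_coe_le_dist
              (f := β) (g := β') r) (mul_nonneg (hw.nonneg r) (Real.exp_pos (2 * prim g r)).le)
            linarith
        _ ≤ _ := by
            rw [intervalIntegral.integral_const_mul]
            exact mul_le_mul_of_nonneg_left (integral_mul_exp_le hw.integrable _ _) dist_nonneg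
    rw [dist_eq_norm, h1, norm_smul, Real.norm_eq_abs, abs_of_pos (Real.exp_pos _)]
    rcases le_total s t with hst | hst
    · rw [max_eq_right hst] at h2 ⊢
      have h5 : Real.exp (2 * prim g t) * Real.exp (-(2 * prim g t)) = 1 := by
        rw [← Real.exp_add]; simp
      refine (mul_le_mul_of_nonneg_left h2 (Real.exp_pos _).le).trans (le_of_eq ?_)
      push_cast
      linear_combination (dist β β' / 2) * h5
    · rw [max_eq_left hst, intervalIntegral.integral_same, norm_zero, mul_zero]
      positivity
  have hfix : Q hQ.fixedPoint = hQ.fixedPoint := hQ.fixedPoint_isFixedPt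
  set β := hQ.fixedPoint
  refine ⟨fun t => Real.exp (2 * prim g t) • β t, by fun_prop, fun t => ?_⟩
  have h1 : β t = Q₀ β t := (DFunLike.congr_fun hfix t).symm
  change Real.exp (2 * prim g t) • β t = _
  rw [h1, smul_smul, ← Real.exp_add, add_neg_cancel, Real.exp_zero, one_smul]

variable [CompleteSpace E]

/-- The position at time `t` of the integral curve that is at `x` at time `s`; for `t ≤ s` it
is `x`. -/
noncomputable def flow (hw : LipField w g) (s t : ℝ) (x : E) : E :=
  (hw.exists_integralCurve s x).choose t

theorem continuous_flow (hw : LipField w g) (s : ℝ) (x : E) : Continuous fun t => hw.flow s t x :=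
  (hw.exists_integralCurve s x).choose_spec.1

theorem flow_eq_max (hw : LipField w g) (s t : ℝ) (x : E) :
    hw.flow s t x = x + ∫ r in s..max s t, w r (hw.flow s r x) :=
  (hw.exists_integralCurve s x).choose_spec.2 t

theorem flow_eq (hw : LipField w g) {s t : ℝ} (hst : s ≤ t) (x : E) :
    hw.flow s t x = x + ∫ r in s..t, w r (hw.flow s r x) := by
  rw [flow_eq_max, max_eq_right hst]

theorem flow_of_le (hw : LipField w g) {s t : ℝ} (hst : t ≤ s) (x : E) :
    hw.flow s t x = x := by
  rw [flow_eq_max, max_eq_left hst, intervalIntegral.integral_same, add_zero]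

theorem norm_flow_sub_flow_le (hw : LipField w g) (s t : ℝ) (x y : E) :
    ‖hw.flow s t x - hw.flow s t y‖ ≤ 2 * Real.exp (2 * ∫ r, g r) * ‖x - y‖ := by
  rcases le_total s t with hst | hst
  · exact hw.norm_sub_le_of_integral_eq hst (hw.continuous_flow s x).continuousOn
      (hw.continuous_flow s y).continuousOn (fun r hr => hw.flow_eq hr.1 x)
      (fun r hr => hw.flow_eq hr.1 y)
  · rw [hw.flow_of_le hst, hw.flow_of_le hst]
    have h1 : 1 ≤ Real.exp (2 * ∫ r, g r) :=
      Real.one_le_exp (mul_nonneg zero_le_two (integral_nonneg hw.nonneg))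
    nlinarith [norm_nonneg (x - y)]

theorem continuous_uncurry_flow (hw : LipField w g) (s : ℝ) :
    Continuous fun p : ℝ × E => hw.flow s p.1 p.2 := by
  have h : Continuous fun p : E × ℝ => hw.flow s p.2 p.1 := by
    refine continuous_prod_of_continuous_lipschitzWith _
      (Real.toNNReal (2 * Real.exp (2 * ∫ r, g r))) (fun x => hw.continuous_flow s x)
      fun t => LipschitzWith.of_dist_le_mul fun x y => ?_
    rw [dist_eq_norm, dist_eq_norm, Real.coe_toNNReal _ (by positivity)]
    exact hw.norm_flow_sub_flow_le s t x y
  exact h.comp continuous_swap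

theorem eq_flow (hw : LipField w g) {γ : ℝ → E} {s t : ℝ} {x : E} (hst : s ≤ t)
    (hγ : ContinuousOn γ (Icc s t))
    (h : ∀ r ∈ Icc s t, γ r = x + ∫ q in s..r, w q (γ q)) : γ t = hw.flow s t x := by
  have := hw.norm_sub_le_of_integral_eq hst hγ (hw.continuous_flow s x).continuousOn h
    (fun r hr => hw.flow_eq hr.1 x)
  rw [sub_self, norm_zero, mul_zero, norm_le_zero_iff, sub_eq_zero] at this
  exact this

theorem flow_flow (hw : LipField w g) {s s' t : ℝ} (h1 : s ≤ s') (h2 : s' ≤ t) (x : E) :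
    hw.flow s' t (hw.flow s s' x) = hw.flow s t x := by
  refine (hw.eq_flow h2 (hw.continuous_flow s x).continuousOn fun r hr => ?_).symm
  have hint : ∀ a b, IntervalIntegrable (fun r => w r (hw.flow s r x)) volume a b := fun a b =>
    hw.intervalIntegrable_comp (hw.continuous_flow s x).continuousOn
  rw [hw.flow_eq (h1.trans hr.1), hw.flow_eq h1, add_assoc,
    intervalIntegral.integral_add_adjacent_intervals (hint _ _) (hint _ _)]

theorem norm_flow_sub_le (hw : LipField w g) {s t : ℝ} (hst : s ≤ t) (x : E) :
    ‖hw.flow s t x - x‖ ≤ ∫ r in s..t, g r := by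
  rw [hw.flow_eq hst, add_sub_cancel_left]
  exact hw.norm_integral_le _ hst

theorem absolutelyContinuousOnInterval_integral (hw : LipField w g) {γ : ℝ → E} {s t : ℝ}
    (hst : s ≤ t) (hγ : ContinuousOn γ (Icc s t)) :
    AbsolutelyContinuousOnInterval (fun r => ∫ q in s..r, w q (γ q)) s t := by
  refine absolutelyContinuousOnInterval_of_dist_le (K := 1)
    (absolutelyContinuousOnInterval_prim hw.integrable s t) ?_
  rw [uIcc_of_le hst]
  have hint : ∀ a ∈ Icc s t, ∀ b ∈ Icc s t,
      IntervalIntegrable (fun r => w r (γ r)) volume a b := fun a ha b hb =>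
    hw.intervalIntegrable_comp (hγ.mono (ordConnected_Icc.uIcc_subset ha hb))
  have key : ∀ a ∈ Icc s t, ∀ b ∈ Icc s t, a ≤ b →
      dist (∫ q in s..a, w q (γ q)) (∫ q in s..b, w q (γ q))
        ≤ 1 * dist (prim g a) (prim g b) := fun a ha b hb hab => by
    have hs : s ∈ Icc s t := ⟨le_rfl, hst⟩
    rw [dist_comm, dist_eq_norm, dist_comm (prim g a), Real.dist_eq,
      intervalIntegral.integral_interval_sub_left (hint s hs b hb) (hint s hs a ha),
      prim_sub_prim hw.integrable, one_mul]
    exact (hw.norm_integral_le γ hab).trans (le_abs_self _)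
  intro a ha b hb
  rcases le_total a b with hab | hab
  · exact key a ha b hb hab
  · rw [dist_comm, dist_comm (prim g a)]
    exact key b hb a ha hab

theorem absolutelyContinuousOnInterval_flow (hw : LipField w g) {s t : ℝ} (hst : s ≤ t) (x : E) :
    AbsolutelyContinuousOnInterval (fun r => hw.flow s r x) s t := by
  refine absolutelyContinuousOnInterval_of_dist_le (K := 1)
    (hw.absolutelyContinuousOnInterval_integral hst (hw.continuous_flow s x).continuousOn) ?_
  rw [uIcc_of_le hst]
  intro a ha b hb
  rw [hw.flow_eq ha.1, hw.flow_eq hb.1, dist_add_left, one_mul]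

theorem ae_hasDerivAt_flow (hw : LipField w g) (s : ℝ) (x : E) :
    ∀ᵐ t, s < t → HasDerivAt (fun r => hw.flow s r x) (w t (hw.flow s t x)) t := by
  have hint : Integrable fun r => w r (hw.flow s r x) :=
    integrableOn_univ.mp
      (hw.integrableOn_comp MeasurableSet.univ (hw.continuous_flow s x).continuousOn)
  filter_upwards [LocallyIntegrable.ae_hasDerivAt_integral hint.locallyIntegrable] with t ht hst
  refine ((ht s).const_add x).congr_of_eventuallyEq ?_
  filter_upwards [lt_mem_nhds hst] with r hr
  exact hw.flow_eq hr.le x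

/-- An absolutely continuous solution of the differential equation satisfies the integral
equation. -/
theorem eq_add_integral_of_ae_hasDerivAt (hw : LipField w g) {γ : ℝ → E} {s t : ℝ} (hst : s ≤ t)
    (hγ : AbsolutelyContinuousOnInterval γ s t)
    (h : ∀ᵐ r, r ∈ Ioo s t → HasDerivAt γ (w r (γ r)) r) :
    ∀ r ∈ Icc s t, γ r = γ s + ∫ q in s..r, w q (γ q) := by
  have hc : ContinuousOn γ (Icc s t) := by
    rw [← uIcc_of_le hst]; exact hγ.continuousOn
  have hac := hγ.sub (hw.absolutelyContinuousOnInterval_integral hst hc)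
  have hint : IntervalIntegrable (fun r => w r (γ r)) volume s t :=
    hw.intervalIntegrable_comp (by rwa [uIcc_of_le hst])
  have h0 : ∀ᵐ r, r ∈ uIcc s t →
      HasDerivAt (γ - fun r => ∫ q in s..r, w q (γ q)) 0 r := by
    have hs : ∀ᵐ r : ℝ, r ≠ s := by simp [ae_iff]
    have ht : ∀ᵐ r : ℝ, r ≠ t := by simp [ae_iff]
    filter_upwards [h, IntervalIntegrable.ae_hasDerivAt_integral hint, hs, ht]
      with r h1 h2 hrs hrt hr
    have hr' := hr
    rw [uIcc_of_le hst] at hr'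
    have h3 := (h1 ⟨lt_of_le_of_ne hr'.1 hrs.symm, lt_of_le_of_ne hr'.2 hrt⟩).sub
      (h2 hr s left_mem_uIcc)
    rwa [sub_self] at h3
  obtain ⟨C, hC⟩ := hac.const_of_ae_hasDerivAt_zero h0
  rw [uIcc_of_le hst] at hC
  intro r hr
  have h1 := hC r hr
  have h2 := hC s ⟨le_rfl, hst⟩
  simp only [Pi.sub_apply, intervalIntegral.integral_same, sub_zero] at h1 h2
  rw [h2, ← h1]
  abel

end LipField

end Flow

/-! ### Mollification of Lipschitz functions -/

section Mollify

variable {E : Type*} [NormedAddCommGroup E] [InnerProductSpace ℝ E] [FiniteDimensional ℝ E]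
  [MeasurableSpace E] [BorelSpace E]

/-- The convolution of `f` with the normalized bump function `ρ`. -/
noncomputable def mollify (ρ : ContDiffBump (0 : E)) (f : E → ℝ) (x : E) : ℝ :=
  ∫ y, ρ.normed volume y * f (x - y)

variable (ρ : ContDiffBump (0 : E)) {f f' : E → ℝ}

theorem mollify_eq_convolution (f : E → ℝ) :
    mollify ρ f = convolution (ρ.normed volume) f (ContinuousLinearMap.mul ℝ ℝ) volume := rfl

theorem integrable_mollify (hf : Continuous f) (x : E) :
    Integrable fun y => ρ.normed volume y * f (x - y) :=
  ((ρ.continuous_normed (μ := volume)).mul (by fun_prop)).integrable_of_hasCompactSupport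
    ρ.hasCompactSupport_normed.mul_right

/-- Two mollified functions differ by at most the difference of the functions on the support of the
mollifier. -/
theorem abs_mollify_sub_mollify_le (hf : Continuous f) (hf' : Continuous f') {x x' : E} {δ : ℝ}
    (h : ∀ y, ‖y‖ ≤ ρ.rOut → |f (x - y) - f' (x' - y)| ≤ δ) :
    |mollify ρ f x - mollify ρ f' x'| ≤ δ := by
  rw [mollify, mollify, ← integral_sub (integrable_mollify ρ hf x) (integrable_mollify ρ hf' x')]
  rw [← Real.norm_eq_abs]
  calc _ ≤ ∫ y, ρ.normed volume y * δ := by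
        have hρ : Integrable fun y => ρ.normed volume y * δ := ρ.integrable_normed.mul_const δ
        refine norm_integral_le_of_norm_le hρ (Eventually.of_forall fun y => ?_)
        rw [← mul_sub, norm_mul, Real.norm_eq_abs, abs_of_nonneg (ρ.nonneg_normed y)]
        rcases le_or_gt ‖y‖ ρ.rOut with hy | hy
        · exact mul_le_mul_of_nonneg_left (h y hy) (ρ.nonneg_normed y)
        · have : ρ.normed volume y = 0 := by
            rw [← Function.notMem_support, ρ.support_normed_eq]
            simpa using hy.le
          simp [this]
    _ = δ := by rw [integral_mul_const, ρ.integral_normed, one_mul]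

theorem mollify_const (c : ℝ) (x : E) : mollify ρ (fun _ => c) x = c := by
  rw [mollify, integral_mul_const, ρ.integral_normed, one_mul]

theorem abs_mollify_sub_le {K : ℝ≥0} (hf : LipschitzWith K f) (x : E) :
    |mollify ρ f x - f x| ≤ K * ρ.rOut := by
  conv_lhs => rw [← mollify_const ρ (f x) x]
  refine abs_mollify_sub_mollify_le ρ hf.continuous continuous_const fun y hy => ?_
  have := hf.dist_le_mul (x - y) x
  rw [Real.dist_eq, dist_eq_norm] at this
  refine this.trans (mul_le_mul_of_nonneg_left ?_ K.2)
  simpa using hy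

theorem abs_mollify_le {C : ℝ} (hf : Continuous f) (hC : ∀ x, |f x| ≤ C) (x : E) :
    |mollify ρ f x| ≤ C := by
  have := abs_mollify_sub_mollify_le ρ hf continuous_const (f' := fun _ => 0) (x := x) (x' := x)
    (δ := C) fun y _ => by simpa using hC _
  rwa [mollify_const, sub_zero] at this

theorem lipschitzWith_mollify {K : ℝ≥0} (hf : LipschitzWith K f) :
    LipschitzWith K (mollify ρ f) :=
  LipschitzWith.of_dist_le_mul fun x x' => by
    rw [Real.dist_eq]
    refine abs_mollify_sub_mollify_le ρ hf.continuous hf.continuous fun y _ => ?_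
    have := hf.dist_le_mul (x - y) (x' - y)
    rwa [Real.dist_eq, dist_sub_right] at this

theorem contDiff_mollify (hf : Continuous f) : ContDiff ℝ ∞ (mollify ρ f) := by
  rw [mollify_eq_convolution]
  exact ρ.hasCompactSupport_normed.contDiff_convolution_left _
    ρ.contDiff_normed hf.locallyIntegrable

theorem hasCompactSupport_mollify (hf : HasCompactSupport f) : HasCompactSupport (mollify ρ f) := by
  rw [mollify_eq_convolution]
  exact ρ.hasCompactSupport_normed.convolution _ hf

/-- The gradient of a mollified Lipschitz function is Lipschitz, with a constant that depends on the
function only through its Lipschitz constant. -/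
theorem exists_norm_fderiv_mollify_sub_le : ∃ C : ℝ, 0 ≤ C ∧ ∀ (K : ℝ≥0) (f : E → ℝ),
    LipschitzWith K f → ∀ x x',
      ‖fderiv ℝ (mollify ρ f) x - fderiv ℝ (mollify ρ f) x'‖ ≤ C * K * ‖x - x'‖ := by
  set D := fderiv ℝ (ρ.normed (volume : Measure E)) with hD
  have hDc : HasCompactSupport D := ρ.hasCompactSupport_normed.fderiv ℝ
  have hDcont : Continuous D :=
    (ρ.contDiff_normed (n := 1)).continuous_fderiv (by norm_num)
  refine ⟨∫ y, ‖D y‖, integral_nonneg fun _ => norm_nonneg _, fun K f hf x x' => ?_⟩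
  have hder : ∀ x, fderiv ℝ (mollify ρ f) x = ∫ y, f (x - y) • D y := fun x => by
    rw [mollify_eq_convolution, (ρ.hasCompactSupport_normed.hasFDerivAt_convolution_left
      (ContinuousLinearMap.mul ℝ ℝ) ρ.contDiff_normed hf.continuous.locallyIntegrable x).fderiv,
      convolution_def]
    refine integral_congr_ae (Eventually.of_forall fun y => ?_)
    ext z
    simp [ContinuousLinearMap.precompL_apply, hD, mul_comm]
  have hint : ∀ x, Integrable fun y => f (x - y) • D y := fun x =>
    (Continuous.smul (hf.continuous.comp (by fun_prop)) hDcont).integrable_of_hasCompactSupport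
      hDc.smul_left
  have hDint : Integrable fun y => ‖D y‖ :=
    (hDcont.integrable_of_hasCompactSupport hDc).norm
  rw [hder, hder, ← integral_sub (hint x) (hint x')]
  calc _ ≤ ∫ y, ‖D y‖ * (K * ‖x - x'‖) := by
        refine norm_integral_le_of_norm_le (hDint.mul_const _)
          (Eventually.of_forall fun y => ?_)
        rw [← sub_smul, norm_smul, mul_comm]
        refine mul_le_mul_of_nonneg_left ?_ (norm_nonneg _)
        have := hf.dist_le_mul (x - y) (x' - y)
        rwa [dist_sub_right, dist_eq_norm, dist_eq_norm] at this
    _ = _ := by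
        rw [integral_mul_const]
        ring

end Mollify

/-! ### Smooth steps -/

section Step

theorem integrable_deriv_smoothTransition : Integrable (deriv Real.smoothTransition) ∧
    Continuous (deriv Real.smoothTransition) ∧
    HasCompactSupport (deriv Real.smoothTransition) := by
  have hc : Continuous (deriv Real.smoothTransition) :=
    (Real.smoothTransition.contDiff (n := 1)).continuous_deriv (by norm_num)
  have hs : HasCompactSupport (deriv Real.smoothTransition) := by
    refine HasCompactSupport.intro (isCompact_Icc (a := (0 : ℝ)) (b := 1)) fun u hu => ?_
    rw [mem_Icc, not_and_or, not_le, not_le] at hu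
    rcases hu with hu | hu
    · have h : Real.smoothTransition =ᶠ[𝓝 u] fun _ => 0 := by
        filter_upwards [gt_mem_nhds hu] with r hr
        exact Real.smoothTransition.zero_of_nonpos hr.le
      rw [h.deriv_eq, deriv_const]
    · have h : Real.smoothTransition =ᶠ[𝓝 u] fun _ => 1 := by
        filter_upwards [lt_mem_nhds hu] with r hr
        exact Real.smoothTransition.one_of_one_le hr.le
      rw [h.deriv_eq, deriv_const]
  exact ⟨hc.integrable_of_hasCompactSupport hs, hc, hs⟩

theorem integral_deriv_smoothTransition : ∫ u, deriv Real.smoothTransition u = 1 := by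
  have h := integral_of_hasDerivAt_of_tendsto (f := Real.smoothTransition) (m := 0) (n := 1)
    (fun x => ((Real.smoothTransition.contDiff (n := 1)).differentiable (by norm_num)
      x).hasDerivAt) integrable_deriv_smoothTransition.1 ?_ ?_
  · rw [h, sub_zero]
  · refine tendsto_const_nhds.congr' ?_
    filter_upwards [eventually_le_atBot 0] with r hr
    exact (Real.smoothTransition.zero_of_nonpos hr).symm
  · refine tendsto_const_nhds.congr' ?_
    filter_upwards [eventually_ge_atTop 1] with r hr
    exact (Real.smoothTransition.one_of_one_le hr).symm

/-- A smooth function that is `0` up to time `s + δ` and `1` from time `s + 2 * δ` on. -/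
noncomputable def smoothStep (s δ r : ℝ) : ℝ := Real.smoothTransition ((r - s) / δ - 1)

variable {s δ : ℝ}

theorem contDiff_smoothStep (s δ : ℝ) : ContDiff ℝ ∞ (smoothStep s δ) :=
  Real.smoothTransition.contDiff.comp (by fun_prop)

theorem smoothStep_eq_zero (hδ : 0 < δ) {r : ℝ} (hr : r ≤ s + δ) : smoothStep s δ r = 0 := by
  refine Real.smoothTransition.zero_of_nonpos ?_
  rw [sub_nonpos, div_le_one hδ]
  linarith

theorem smoothStep_eq_one (hδ : 0 < δ) {r : ℝ} (hr : s + 2 * δ ≤ r) : smoothStep s δ r = 1 := by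
  refine Real.smoothTransition.one_of_one_le ?_
  rw [le_sub_iff_add_le, le_div_iff₀ hδ]
  linarith

theorem deriv_smoothStep (s δ r : ℝ) :
    deriv (smoothStep s δ) r = δ⁻¹ * deriv Real.smoothTransition ((r - s) / δ - 1) := by
  have h1 : HasDerivAt (fun r => (r - s) / δ - 1) (1 / δ) r :=
    (((hasDerivAt_id r).sub_const s).div_const δ).sub_const 1
  have h2 := (((Real.smoothTransition.contDiff (n := 1)).differentiable (by norm_num)
    ((r - s) / δ - 1)).hasDerivAt).comp r h1
  rw [show smoothStep s δ = Real.smoothTransition ∘ fun r => (r - s) / δ - 1 from rfl, h2.deriv,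
    one_div, mul_comm]

theorem integral_deriv_smoothStep_mul (hδ : 0 < δ) (m : ℝ → ℝ) :
    ∫ r, deriv (smoothStep s δ) r * m r =
      ∫ u, deriv Real.smoothTransition u * m (s + δ * (u + 1)) := by
  set G : ℝ → ℝ := fun u => deriv Real.smoothTransition (u - 1) * m (s + δ * (u - 1 + 1)) with hG
  calc ∫ r, deriv (smoothStep s δ) r * m r = ∫ r, δ⁻¹ * G ((r - s) / δ) := by
        refine integral_congr_ae (Eventually.of_forall fun r => ?_)
        have h : s + δ * ((r - s) / δ - 1 + 1) = r := by field_simp; ring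
        simp only [hG, deriv_smoothStep, h]
        ring
    _ = δ⁻¹ * ∫ r, G (r / δ) := by
        rw [integral_const_mul, integral_sub_right_eq_self (fun r => G (r / δ)) s]
    _ = ∫ u, G u := by
        rw [Measure.integral_comp_div G δ, abs_of_pos hδ, smul_eq_mul,
          inv_mul_cancel_left₀ hδ.ne']
    _ = _ := integral_sub_right_eq_self
        (fun u => deriv Real.smoothTransition u * m (s + δ * (u + 1))) (1 : ℝ)

theorem tendsto_integral_deriv_smoothStep_mul {δ : ℕ → ℝ} (hδ : ∀ n, 0 < δ n)
    (hδ0 : Tendsto δ atTop (𝓝 0)) (s : ℝ) {m : ℝ → ℝ} (hm : Continuous m) {C : ℝ}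
    (hC : ∀ r, ‖m r‖ ≤ C) :
    Tendsto (fun n => ∫ r, deriv (smoothStep s (δ n)) r * m r) atTop (𝓝 (m s)) := by
  obtain ⟨hi, hc, -⟩ := integrable_deriv_smoothTransition
  have h1 : m s = ∫ u, deriv Real.smoothTransition u * m s := by
    rw [integral_mul_const, integral_deriv_smoothTransition, one_mul]
  rw [h1]
  simp only [integral_deriv_smoothStep_mul (hδ _)]
  refine tendsto_integral_of_dominated_convergence
    (fun u => ‖deriv Real.smoothTransition u‖ * C) (fun n => ?_) (hi.norm.mul_const C)
    (fun n => Eventually.of_forall fun u => ?_) (Eventually.of_forall fun u => ?_)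
  · exact (hc.mul (hm.comp (by fun_prop))).aestronglyMeasurable
  · rw [norm_mul]
    exact mul_le_mul_of_nonneg_left (hC _) (norm_nonneg _)
  · refine ((hm.tendsto s).comp ?_).const_mul _
    have := (hδ0.mul_const (u + 1)).const_add s
    rwa [zero_mul, add_zero] at this

end Step


/-! ### The continuity equation tested with functions of the space variable -/

section Weak

set_option linter.unusedSectionVars false

open ProbabilityTheory

variable {E : Type*} [NormedAddCommGroup E] [InnerProductSpace ℝ E] [FiniteDimensional ℝ E]
  [MeasurableSpace E] [BorelSpace E]

theorem measurable_coe_of_continuous {μ : ℝ → ProbabilityMeasure E} (hμ : Continuous μ) :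
    Measurable fun t => (μ t : Measure E) := by
  refine Measurable.measure_of_isPiSystem_of_isProbabilityMeasure
    (by rw [BorelSpace.measurable_eq (α := E), borel_eq_generateFrom_isClosed])
    isPiSystem_isClosed fun F hF => ?_
  refine measurable_of_tendsto_metrizable (f := fun n t => ∫⁻ x, (hF.apprSeq n x : ENNReal) ∂(μ t))
    (fun n => ?_) (tendsto_pi_nhds.mpr fun t =>
      HasOuterApproxClosed.tendsto_lintegral_apprSeq hF (μ t : Measure E))
  have h : Continuous fun t => ((μ t).toFiniteMeasure.testAgainstNN (hF.apprSeq n) : ENNReal) :=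
    ENNReal.continuous_coe.comp
      ((ProbabilityMeasure.continuous_testAgainstNN_eval (hF.apprSeq n)).comp hμ)
  simp only [FiniteMeasure.testAgainstNN_coe_eq] at h
  exact h.measurable

theorem measurable_clm_apply {α : Type*} [MeasurableSpace α] {L : α → E →L[ℝ] ℝ} {u : α → E}
    (hL : StronglyMeasurable L) (hu : Measurable u) : Measurable fun a => L a (u a) :=
  ((isBoundedBilinearMap_apply (𝕜 := ℝ) (E := E) (F := ℝ)).continuous.comp_stronglyMeasurable
    (hL.prodMk hu.stronglyMeasurable)).measurable

/-- A narrowly continuous curve of probability measures, as a Markov kernel. -/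
noncomputable def curveKernel {μ : ℝ → ProbabilityMeasure E} (hμ : Continuous μ) : Kernel ℝ E where
  toFun t := μ t
  measurable' := measurable_coe_of_continuous hμ

theorem curveKernel_apply {μ : ℝ → ProbabilityMeasure E} (hμ : Continuous μ) (t : ℝ) :
    curveKernel hμ t = μ t := rfl

instance {μ : ℝ → ProbabilityMeasure E} (hμ : Continuous μ) : IsMarkovKernel (curveKernel hμ) :=
  ⟨fun t => by rw [curveKernel_apply]; infer_instance⟩

/-- A narrowly continuous curve of probability measures that solves the continuity equation with
velocity `v` at positive times, with locally integrable `L¹` norms of the velocity. The curve is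
parametrized by the whole real line, but only nonnegative times carry information. -/
structure WeakSolution (v : ℝ → E → E) (μ : ℝ → ProbabilityMeasure E) : Prop where
  measurable : Measurable (fun p : ℝ × E => v p.1 p.2)
  continuous : Continuous μ
  lintegral_lt_top : ∀ T : ℝ, ∫⁻ t in Icc 0 T, ∫⁻ x, ‖v t x‖ₑ ∂(μ t : Measure E) < ⊤
  weak : ∀ φ : ℝ × E → ℝ, ContDiff ℝ ∞ φ → HasCompactSupport φ → tsupport φ ⊆ Ioi 0 ×ˢ univ →
    ∫ t in Ioi (0 : ℝ), (∫ x, (deriv (fun s => φ (s, x)) t +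
      fderiv ℝ (fun y => φ (t, y)) x (v t x)) ∂(μ t : Measure E)) = 0

/-- The `L¹` norm of the velocity at time `t`. -/
noncomputable def speed (v : ℝ → E → E) (μ : ℝ → ProbabilityMeasure E) (t : ℝ) : ℝ :=
  ∫ x, ‖v t x‖ ∂(μ t : Measure E)

theorem speed_nonneg (v : ℝ → E → E) (μ : ℝ → ProbabilityMeasure E) (t : ℝ) :
    0 ≤ speed v μ t := integral_nonneg fun _ => norm_nonneg _

namespace WeakSolution

variable {v : ℝ → E → E} {μ : ℝ → ProbabilityMeasure E}

theorem integrable_uncurry (h : WeakSolution v μ) (T : ℝ) :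
    Integrable (fun p : ℝ × E => v p.1 p.2)
      ((volume.restrict (Icc 0 T)) ⊗ₘ (curveKernel h.continuous)) := by
  refine ⟨h.measurable.aestronglyMeasurable, ?_⟩
  rw [hasFiniteIntegral_iff_enorm, Measure.lintegral_compProd h.measurable.enorm]
  exact h.lintegral_lt_top T

theorem integrable_of_norm_le (h : WeakSolution v μ) {T C : ℝ} {H : ℝ → E → ℝ}
    (hH : Measurable fun p : ℝ × E => H p.1 p.2) (hC : ∀ t x, ‖H t x‖ ≤ C * ‖v t x‖) :
    Integrable (fun p : ℝ × E => H p.1 p.2)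
      ((volume.restrict (Icc 0 T)) ⊗ₘ (curveKernel h.continuous)) :=
  ((h.integrable_uncurry T).norm.const_mul C).mono' hH.aestronglyMeasurable
    (Eventually.of_forall fun p => hC p.1 p.2)

theorem integrableOn_integral (h : WeakSolution v μ) (T : ℝ) {C : ℝ} {H : ℝ → E → ℝ}
    (hH : Measurable fun p : ℝ × E => H p.1 p.2) (hC : ∀ t x, ‖H t x‖ ≤ C * ‖v t x‖) :
    IntegrableOn (fun t => ∫ x, H t x ∂(μ t : Measure E)) (Icc 0 T) := by
  have h1 := h.integrable_of_norm_le (T := T) hH hC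
  rw [Measure.compProd] at h1
  simpa using! h1.integral_compProd

theorem intervalIntegrable_integral (h : WeakSolution v μ) {C s t : ℝ} (hs : 0 ≤ s) (ht : 0 ≤ t)
    {H : ℝ → E → ℝ} (hH : Measurable fun p : ℝ × E => H p.1 p.2)
    (hC : ∀ t x, ‖H t x‖ ≤ C * ‖v t x‖) :
    IntervalIntegrable (fun t => ∫ x, H t x ∂(μ t : Measure E)) volume s t :=
  ((h.integrableOn_integral (max s t) hH hC).mono_set
    (Icc_subset_Icc_left (le_min hs ht))).intervalIntegrable

theorem intervalIntegrable_speed (h : WeakSolution v μ) {s t : ℝ} (hs : 0 ≤ s) (ht : 0 ≤ t) :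
    IntervalIntegrable (speed v μ) volume s t :=
  h.intervalIntegrable_integral (C := 1) hs ht h.measurable.norm fun t x => by simp

theorem ae_integrable (h : WeakSolution v μ) :
    ∀ᵐ t, 0 ≤ t → Integrable (v t) (μ t : Measure E) := by
  have h1 : ∀ n : ℕ, ∀ᵐ t, t ∈ Icc (0 : ℝ) n → Integrable (v t) (μ t : Measure E) := fun n =>
    (ae_restrict_iff' measurableSet_Icc).mp ((Measure.integrable_compProd_iff
      h.measurable.aestronglyMeasurable).mp (h.integrable_uncurry n)).1
  filter_upwards [ae_all_iff.mpr h1] with t ht ht0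
  obtain ⟨n, hn⟩ := exists_nat_ge t
  exact ht n ⟨ht0, hn⟩

theorem integrable_clm (h : WeakSolution v μ) {t : ℝ} (ht : Integrable (v t) (μ t : Measure E))
    {L : E → E →L[ℝ] ℝ} (hL : Continuous L) {C : ℝ} (hC : ∀ x, ‖L x‖ ≤ C) :
    Integrable (fun x => L x (v t x)) (μ t : Measure E) := by
  refine (ht.norm.const_mul C).mono' ?_
    (Eventually.of_forall fun x => (L x).le_of_opNorm_le (hC x) _)
  exact (measurable_clm_apply hL.stronglyMeasurable
    (h.measurable.comp measurable_prodMk_left)).aestronglyMeasurable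

theorem continuous_integral (h : WeakSolution v μ) {f : E → ℝ} (hf : Continuous f) {C : ℝ}
    (hC : ∀ x, ‖f x‖ ≤ C) : Continuous fun t => ∫ x, f x ∂(μ t : Measure E) :=
  (ProbabilityMeasure.continuous_integral_boundedContinuousFunction
    (BoundedContinuousFunction.ofNormedAddCommGroup f hf C hC)).comp h.continuous

theorem abs_integral_le {f : E → ℝ} {C : ℝ} (hC : ∀ x, ‖f x‖ ≤ C) (t : ℝ) :
    ‖∫ x, f x ∂(μ t : Measure E)‖ ≤ C := by
  simpa using norm_integral_le_of_norm_le_const (μ := (μ t : Measure E)) (Eventually.of_forall hC)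

section Smooth

variable {f : E → ℝ}

theorem exists_norm_le_of_hasCompactSupport (hf : ContDiff ℝ ∞ f)
    (hfc : HasCompactSupport f) : ∃ C, ∀ x, ‖f x‖ ≤ C :=
  hfc.exists_bound_of_continuous hf.continuous

theorem exists_norm_fderiv_le_of_hasCompactSupport (hf : ContDiff ℝ ∞ f)
    (hfc : HasCompactSupport f) : ∃ C, ∀ x, ‖fderiv ℝ f x‖ ≤ C :=
  (hfc.fderiv ℝ).exists_bound_of_continuous (hf.continuous_fderiv (by simp))

theorem measurable_fderiv_apply (h : WeakSolution v μ) (hf : ContDiff ℝ ∞ f) :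
    Measurable fun p : ℝ × E => fderiv ℝ f p.2 (v p.1 p.2) :=
  measurable_clm_apply (((hf.continuous_fderiv (by simp)).comp continuous_snd).stronglyMeasurable)
    h.measurable

theorem intervalIntegrable_fderiv_apply (h : WeakSolution v μ) (hf : ContDiff ℝ ∞ f)
    (hfc : HasCompactSupport f) {s t : ℝ} (hs : 0 ≤ s)
    (ht : 0 ≤ t) :
    IntervalIntegrable (fun r => ∫ x, fderiv ℝ f x (v r x) ∂(μ r : Measure E)) volume s t := by
  obtain ⟨C, hC⟩ := exists_norm_fderiv_le_of_hasCompactSupport hf hfc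
  exact h.intervalIntegrable_integral hs ht (h.measurable_fderiv_apply hf)
    fun t x => (fderiv ℝ f x).le_of_opNorm_le (hC x) _

/-- The continuity equation tested with a product `η t * f x`. -/
theorem integral_product_eq_zero (h : WeakSolution v μ) (hf : ContDiff ℝ ∞ f)
    (hfc : HasCompactSupport f) {η : ℝ → ℝ} (hη : ContDiff ℝ ∞ η)
    (hηc : HasCompactSupport η) (hηs : tsupport η ⊆ Ioi 0) :
    ∫ t in Ioi (0 : ℝ), (deriv η t * (∫ x, f x ∂(μ t : Measure E)) +
      η t * ∫ x, fderiv ℝ f x (v t x) ∂(μ t : Measure E)) = 0 := by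
  obtain ⟨C, hC⟩ := exists_norm_fderiv_le_of_hasCompactSupport hf hfc
  have hsub : tsupport (fun p : ℝ × E => η p.1 * f p.2) ⊆ tsupport η ×ˢ tsupport f := by
    refine closure_minimal (fun p hp => ?_) ((isClosed_tsupport η).prod (isClosed_tsupport f))
    exact ⟨subset_tsupport η (left_ne_zero_of_mul hp), subset_tsupport f (right_ne_zero_of_mul hp)⟩
  have h1 := h.weak (fun p => η p.1 * f p.2)
    ((hη.comp contDiff_fst).mul (hf.comp contDiff_snd))
    (IsCompact.of_isClosed_subset (hηc.isCompact.prod hfc.isCompact) (isClosed_tsupport _) hsub)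
    (hsub.trans (prod_mono hηs (subset_univ _)))
  refine Eq.trans (setIntegral_congr_ae measurableSet_Ioi ?_) h1
  filter_upwards [h.ae_integrable] with t ht ht0
  have h2 : ∀ x, fderiv ℝ (fun y => η t * f y) x (v t x) = η t * fderiv ℝ f x (v t x) := fun x => by
    rw [fderiv_const_mul ((hf.differentiable (by simp)) x)]
    rfl
  have h3 : ∀ x, deriv (fun s => η s * f x) t = deriv η t * f x := fun x => by
    rw [deriv_mul_const ((hη.differentiable (by simp)) t)]
  simp only [h2, h3]
  rw [integral_add, integral_const_mul, integral_const_mul]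
  · exact (hf.continuous.integrable_of_hasCompactSupport hfc).const_mul _
  · exact (h.integrable_clm (ht ht0.le) (hf.continuous_fderiv (by simp)) hC).const_mul _

/-- The continuity equation tested with a function of the space variable, between two times. It
follows from the distributional form by letting the smooth time cutoffs increase to the indicator of
the time interval. -/
theorem integral_sub_integral_eq (h : WeakSolution v μ) (hf : ContDiff ℝ ∞ f)
    (hfc : HasCompactSupport f) {s t : ℝ} (hs : 0 ≤ s) (hst : s ≤ t) :
    (∫ x, f x ∂(μ t : Measure E)) - ∫ x, f x ∂(μ s : Measure E) =
      ∫ r in s..t, ∫ x, fderiv ℝ f x (v r x) ∂(μ r : Measure E) := by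
  obtain ⟨C, hC⟩ := exists_norm_le_of_hasCompactSupport hf hfc
  set m : ℝ → ℝ := fun t => ∫ x, f x ∂(μ t : Measure E) with hm
  set d : ℝ → ℝ := fun r => ∫ x, fderiv ℝ f x (v r x) ∂(μ r : Measure E) with hd
  have hmc : Continuous m := h.continuous_integral hf.continuous hC
  have hmC : ∀ r, ‖m r‖ ≤ C := abs_integral_le hC
  set δ : ℕ → ℝ := fun n => 1 / ((n : ℝ) + 1) with hδ
  have hδ0 : ∀ n, 0 < δ n := fun n => by positivity
  have hδ1 : ∀ n, δ n ≤ 1 := fun n => by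
    rw [hδ]
    exact (div_le_one (by positivity)).mpr (by linarith [(Nat.cast_nonneg n : (0 : ℝ) ≤ n)])
  have hδt : Tendsto δ atTop (𝓝 0) := tendsto_one_div_add_atTop_nhds_zero_nat
  set η : ℕ → ℝ → ℝ := fun n r => smoothStep s (δ n) r - smoothStep t (δ n) r with hη
  have hηsm : ∀ n, ContDiff ℝ ∞ (η n) := fun n =>
    (contDiff_smoothStep s (δ n)).sub (contDiff_smoothStep t (δ n))
  have hη0 : ∀ n r, r ∉ Icc (s + δ n) (t + 2 * δ n) → η n r = 0 := fun n r hr => by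
    rw [mem_Icc, not_and_or, not_le, not_le] at hr
    rcases hr with hr | hr
    · rw [hη]; dsimp only
      rw [smoothStep_eq_zero (hδ0 n) hr.le, smoothStep_eq_zero (hδ0 n) (by linarith), sub_zero]
    · rw [hη]; dsimp only
      rw [smoothStep_eq_one (hδ0 n) hr.le, smoothStep_eq_one (hδ0 n) (by linarith), sub_self]
  have hηts : ∀ n, tsupport (η n) ⊆ Icc (s + δ n) (t + 2 * δ n) := fun n =>
    closure_minimal (fun r hr => by
      by_contra hr'
      exact hr (hη0 n r hr')) isClosed_Icc
  have hηc : ∀ n, HasCompactSupport (η n) := fun n => HasCompactSupport.intro isCompact_Icc (hη0 n)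
  have hηpos : ∀ n, tsupport (η n) ⊆ Ioi 0 := fun n r hr => by
    have := (hηts n hr).1
    exact lt_of_lt_of_le (by linarith [hδ0 n]) this
  have hη1 : ∀ n r, ‖η n r‖ ≤ 1 := fun n r => by
    have h1 := Real.smoothTransition.nonneg ((r - s) / δ n - 1)
    have h2 := Real.smoothTransition.nonneg ((r - t) / δ n - 1)
    have h3 := Real.smoothTransition.le_one ((r - s) / δ n - 1)
    have h4 := Real.smoothTransition.le_one ((r - t) / δ n - 1)
    rw [hη, Real.norm_eq_abs, abs_le]
    simp only [smoothStep]
    constructor <;> linarith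
  have hdint : IntegrableOn d (Ioc 0 (t + 2)) :=
    (intervalIntegrable_iff_integrableOn_Ioc_of_le (by linarith)).mp
      (h.intervalIntegrable_fderiv_apply hf hfc le_rfl (by linarith))
  set b : ℝ → ℝ := (Ioc 0 (t + 2)).indicator fun r => ‖d r‖ with hb
  have hbint : Integrable b := (integrable_indicator_iff measurableSet_Ioc).mpr hdint.norm
  have hbd : ∀ n r, 0 < r → ‖η n r * d r‖ ≤ b r := fun n r hr => by
    by_cases hr' : r ∈ Ioc 0 (t + 2)
    · rw [hb, indicator_of_mem hr', norm_mul]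
      exact mul_le_of_le_one_left (norm_nonneg _) (hη1 n r)
    · rw [hη0 n r fun hr'' => hr' ⟨hr, by linarith [hr''.2, hδ1 n]⟩, zero_mul, norm_zero]
      exact indicator_nonneg (fun _ _ => norm_nonneg _) r
  have hmeas : ∀ n, AEStronglyMeasurable (fun r => η n r * d r) (volume.restrict (Ioi 0)) := by
    have hdm : StronglyMeasurable d := StronglyMeasurable.integral_kernel_prod_right'
      (κ := curveKernel h.continuous) (h.measurable_fderiv_apply hf).stronglyMeasurable
    exact fun n => ((hηsm n).continuous.stronglyMeasurable.mul hdm).aestronglyMeasurable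
  -- The distributional equation for the cutoff `η n`.
  have hzero : ∀ n, (∫ r, deriv (smoothStep s (δ n)) r * m r) -
      (∫ r, deriv (smoothStep t (δ n)) r * m r) + ∫ r in Ioi (0 : ℝ), η n r * d r = 0 := fun n => by
    have hdc : ∀ s, Continuous (deriv (smoothStep s (δ n))) := fun s =>
      (contDiff_smoothStep s (δ n)).continuous_deriv (by simp)
    have hder : ∀ r, deriv (η n) r = deriv (smoothStep s (δ n)) r - deriv (smoothStep t (δ n)) r :=
      fun r => deriv_sub (((contDiff_smoothStep s (δ n)).differentiable (by simp)) r)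
        (((contDiff_smoothStep t (δ n)).differentiable (by simp)) r)
    have hint : ∀ s, Integrable fun r => deriv (smoothStep s (δ n)) r * m r := fun s => by
      refine ((hdc s).mul hmc).integrable_of_hasCompactSupport ?_
      refine HasCompactSupport.mul_right (HasCompactSupport.intro
        (isCompact_Icc (a := s) (b := s + 3 * δ n)) fun r hr => ?_)
      rw [mem_Icc, not_and_or, not_le, not_le] at hr
      rcases hr with hr | hr
      · have h : smoothStep s (δ n) =ᶠ[𝓝 r] fun _ => 0 := by
          filter_upwards [gt_mem_nhds hr] with q hq
          exact smoothStep_eq_zero (hδ0 n) (by linarith [hδ0 n])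
        rw [h.deriv_eq, deriv_const]
      · have h : smoothStep s (δ n) =ᶠ[𝓝 r] fun _ => 1 := by
          filter_upwards [lt_mem_nhds hr] with q hq
          exact smoothStep_eq_one (hδ0 n) (by linarith [hδ0 n])
        rw [h.deriv_eq, deriv_const]
    have hint' : Integrable fun r => deriv (η n) r * m r := by
      simp only [hder, sub_mul]
      exact (hint s).sub (hint t)
    have h1 := h.integral_product_eq_zero hf hfc (hηsm n) (hηc n) (hηpos n)
    rw [integral_add hint'.integrableOn (hbint.integrableOn.mono' (hmeas n)
      ((ae_restrict_iff' measurableSet_Ioi).mpr (Eventually.of_forall fun r hr => hbd n r hr))),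
      setIntegral_eq_integral_of_forall_compl_eq_zero] at h1
    · simp only [hder, sub_mul] at h1
      rwa [integral_sub (hint s) (hint t)] at h1
    · intro r hr
      have : r ∉ tsupport (deriv (η n)) := fun hr' =>
        hr (hηpos n (tsupport_deriv_subset (𝕜 := ℝ) hr'))
      rw [image_eq_zero_of_notMem_tsupport this, zero_mul]
  have hlim : Tendsto (fun n => ∫ r in Ioi (0 : ℝ), η n r * d r) atTop
      (𝓝 (∫ r in Ioi (0 : ℝ), (Ioc s t).indicator d r)) := by
    refine tendsto_integral_of_dominated_convergence b hmeas hbint.integrableOn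
      (fun n => (ae_restrict_iff' measurableSet_Ioi).mpr
        (Eventually.of_forall fun r hr => hbd n r hr)) (Eventually.of_forall fun r => ?_)
    have hstep : ∀ s < r, ∀ᶠ n in atTop, smoothStep s (δ n) r = 1 := fun s hs => by
      filter_upwards [hδt.eventually_lt_const (show 0 < (r - s) / 2 by linarith)] with n hn
      exact smoothStep_eq_one (hδ0 n) (by linarith)
    refine tendsto_const_nhds.congr' ?_
    rcases le_or_gt r s with hrs | hrs
    · refine Eventually.of_forall fun n => ?_
      change (Ioc s t).indicator d r = η n r * d r
      rw [indicator_of_notMem (fun hr : r ∈ Ioc s t => not_lt.mpr hrs hr.1),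
        hη0 n r fun hr => by linarith [hr.1, hδ0 n], zero_mul]
    · rcases le_or_gt r t with hrt | hrt
      · filter_upwards [hstep s hrs] with n hn
        change (Ioc s t).indicator d r = (smoothStep s (δ n) r - smoothStep t (δ n) r) * d r
        rw [indicator_of_mem (show r ∈ Ioc s t from ⟨hrs, hrt⟩), hn,
          smoothStep_eq_zero (hδ0 n) (by linarith [hδ0 n]), sub_zero, one_mul]
      · filter_upwards [hstep s hrs, hstep t hrt] with n hn hn'
        change (Ioc s t).indicator d r = (smoothStep s (δ n) r - smoothStep t (δ n) r) * d r
        rw [indicator_of_notMem (fun hr : r ∈ Ioc s t => not_lt.mpr hr.2 hrt), hn, hn', sub_self,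
          zero_mul]
  have hlim' := ((tendsto_integral_deriv_smoothStep_mul hδ0 hδt s hmc hmC).sub
    (tendsto_integral_deriv_smoothStep_mul hδ0 hδt t hmc hmC)).add hlim
  simp only [hzero] at hlim'
  have h1 := tendsto_nhds_unique hlim' tendsto_const_nhds
  have hsub : Ioc s t ⊆ Ioi 0 := fun r hr => lt_of_le_of_lt hs hr.1
  rw [setIntegral_indicator measurableSet_Ioc, inter_eq_self_of_subset_right hsub,
    ← intervalIntegral.integral_of_le hst] at h1
  linarith

end Smooth

/-- A curve of measures that is transported with velocity `v` moves in the duality with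
`K`-Lipschitz functions at most at `K` times its speed. -/
theorem abs_integral_sub_integral_le (h : WeakSolution v μ) {f : E → ℝ} {K : ℝ≥0}
    (hf : LipschitzWith K f) (hfc : HasCompactSupport f) {s t : ℝ} (hs : 0 ≤ s) (hst : s ≤ t) :
    |(∫ x, f x ∂(μ t : Measure E)) - ∫ x, f x ∂(μ s : Measure E)| ≤
      K * ∫ r in s..t, speed v μ r := by
  refine le_of_forall_pos_le_add fun ε hε => ?_
  obtain ⟨ρ, hρ⟩ : ∃ ρ : ContDiffBump (0 : E), 2 * (K * ρ.rOut) ≤ ε := by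
    have hpos : 0 < ε / (2 * (K + 1)) := by positivity
    refine ⟨⟨ε / (2 * (K + 1)) / 2, ε / (2 * (K + 1)), by positivity, by linarith⟩, ?_⟩
    change 2 * (K * (ε / (2 * (K + 1)))) ≤ ε
    rw [mul_div_assoc', mul_div_assoc', div_le_iff₀ (by positivity)]
    nlinarith [K.2]
  have hsm := contDiff_mollify ρ hf.continuous
  have hcs := hasCompactSupport_mollify ρ hfc
  have h1 : |(∫ x, mollify ρ f x ∂(μ t : Measure E)) - ∫ x, mollify ρ f x ∂(μ s : Measure E)| ≤
      K * ∫ r in s..t, speed v μ r := by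
    rw [h.integral_sub_integral_eq hsm hcs hs hst, ← intervalIntegral.integral_const_mul,
      ← Real.norm_eq_abs]
    refine intervalIntegral.norm_integral_le_of_norm_le hst ?_
      ((h.intervalIntegrable_speed hs (hs.trans hst)).const_mul _)
    filter_upwards [h.ae_integrable] with r hr hrst
    rw [speed, ← integral_const_mul]
    refine norm_integral_le_of_norm_le ((hr (hs.trans hrst.1.le)).norm.const_mul _)
      (Eventually.of_forall fun x => (fderiv ℝ (mollify ρ f) x).le_of_opNorm_le ?_ _)
    exact norm_fderiv_le_of_lipschitz ℝ (lipschitzWith_mollify ρ hf)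
  have h2 : ∀ r, |(∫ x, mollify ρ f x ∂(μ r : Measure E)) - ∫ x, f x ∂(μ r : Measure E)| ≤
      K * ρ.rOut := fun r => by
    rw [← integral_sub (hsm.continuous.integrable_of_hasCompactSupport hcs)
      (hf.continuous.integrable_of_hasCompactSupport hfc)]
    exact abs_integral_le (fun x => abs_mollify_sub_le ρ hf x) r
  have h3 := abs_le.mp h1
  have h4 := abs_le.mp (h2 s)
  have h5 := abs_le.mp (h2 t)
  rw [abs_le]
  constructor <;> linarith [h3.1, h3.2, h4.1, h4.2, h5.1, h5.2]

end WeakSolution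
end Weak

/-! ### Comparison of the weak solution with the flow of a globally Lipschitz field -/

section Comparison

set_option linter.unusedSectionVars false

variable {E : Type*} [NormedAddCommGroup E] [InnerProductSpace ℝ E] [FiniteDimensional ℝ E]
  [MeasurableSpace E] [BorelSpace E]

theorem abs_taylor_le {f : E → ℝ} (hf : Differentiable ℝ f) {C : ℝ}
    (hC : ∀ x y, ‖fderiv ℝ f x - fderiv ℝ f y‖ ≤ C * ‖x - y‖) (hC0 : 0 ≤ C) (x b : E) :
    |f (x + b) - f x - fderiv ℝ f x b| ≤ C * ‖b‖ ^ 2 := by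
  have h := (convex_segment x (x + b)).norm_image_sub_le_of_norm_hasFDerivWithin_le'
    (f := f) (f' := fderiv ℝ f) (φ := fderiv ℝ f x) (C := C * ‖b‖)
    (fun y _ => (hf y).hasFDerivAt.hasFDerivWithinAt) (fun y hy => ?_)
    (left_mem_segment ℝ x (x + b)) (right_mem_segment ℝ x (x + b))
  · rw [add_sub_cancel_left, Real.norm_eq_abs] at h
    linarith
  · refine (hC y x).trans (mul_le_mul_of_nonneg_left ?_ hC0)
    obtain ⟨a, c, ha, hc, hac, rfl⟩ := hy
    have : a • x + c • (x + b) - x = c • b := by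
      rw [smul_add, ← add_assoc, ← add_smul, hac, one_smul, add_sub_cancel_left]
    rw [this, norm_smul, Real.norm_eq_abs, abs_of_nonneg hc]
    exact mul_le_of_le_one_left (norm_nonneg _) (by linarith)

namespace LipField

variable {w : ℝ → E → E} {g : ℝ → ℝ}

theorem intervalIntegrable_const (hw : LipField w g) (s t : ℝ) (x : E) :
    IntervalIntegrable (fun r => w r x) volume s t :=
  hw.intervalIntegrable_comp (γ := fun _ => x) continuousOn_const

/-- The displacement of `x` in the time interval `[s, t]` when the velocity is frozen at `x`. -/
noncomputable def frozen (w : ℝ → E → E) (s t : ℝ) (x : E) : E := ∫ r in s..t, w r x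

theorem norm_frozen_le (hw : LipField w g) {s t : ℝ} (hst : s ≤ t) (x : E) :
    ‖frozen w s t x‖ ≤ ∫ r in s..t, g r :=
  hw.norm_integral_le (fun _ => x) hst

theorem measurable_frozen (hw : LipField w g) {s t : ℝ} (hst : s ≤ t) :
    Measurable (frozen w s t) := by
  have h1 : frozen w s t = fun x => ∫ r in Ioc s t, w r x := by
    funext x
    exact intervalIntegral.integral_of_le hst
  rw [h1]
  exact ((hw.measurable.comp measurable_swap).stronglyMeasurable.integral_prod_right'
    (ν := volume.restrict (Ioc s t))).measurable

theorem norm_flow_sub_frozen_le (hw : LipField w g) {s t ε : ℝ} (hst : s ≤ t) {x y : E}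
    (hy : ‖y‖ ≤ ε) : ‖hw.flow s t (x - y) - (x - y + frozen w s t x)‖ ≤
      (∫ r in s..t, g r) * ((∫ r in s..t, g r) + ε) := by
  rw [hw.flow_eq hst, add_sub_add_left_eq_sub, frozen, ← intervalIntegral.integral_sub
    (hw.intervalIntegrable_comp (hw.continuous_flow s _).continuousOn)
    (hw.intervalIntegrable_const s t x), ← intervalIntegral.integral_mul_const]
  refine intervalIntegral.norm_integral_le_of_norm_le hst
    (Eventually.of_forall fun r hr => (hw.lip r _ _).trans
      (mul_le_mul_of_nonneg_left ?_ (hw.nonneg r)))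
    (hw.integrable.intervalIntegrable.mul_const _)
  have h1 := hw.norm_flow_sub_le hr.1.le (x - y)
  have h2 : ∫ q in s..r, g q ≤ ∫ q in s..t, g q :=
    intervalIntegral.integral_mono_interval le_rfl hr.1.le hr.2
      (Eventually.of_forall hw.nonneg) hw.integrable.intervalIntegrable
  calc ‖hw.flow s r (x - y) - x‖ = ‖(hw.flow s r (x - y) - (x - y)) - y‖ := by congr 1; abel
    _ ≤ ‖hw.flow s r (x - y) - (x - y)‖ + ‖y‖ := norm_sub_le _ _
    _ ≤ _ := by linarith

/-- The functions `ψ ∘ hw.flow s t` solve the backward transport equation with final value `ψ` at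
time `t`. After a mollification in space, of radius `ρ.rOut`, they are still transported along the
frozen displacement over short time intervals, up to a small error. -/
theorem abs_mollify_flow_sub_le (hw : LipField w g) (ρ : ContDiffBump (0 : E)) {ψ : E → ℝ}
    {K : ℝ≥0} (hψ : LipschitzWith K ψ) {s s' t : ℝ} (h1 : s ≤ s') (h2 : s' ≤ t) (x : E) :
    |mollify ρ (fun y => ψ (hw.flow s' t y)) (x + frozen w s s' x) -
      mollify ρ (fun y => ψ (hw.flow s t y)) x| ≤
      K * (2 * Real.exp (2 * ∫ r, g r)) *
        ((∫ r in s..s', g r) * ((∫ r in s..s', g r) + ρ.rOut)) := by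
  have hc : ∀ s, Continuous fun y => ψ (hw.flow s t y) := fun s =>
    hψ.continuous.comp ((hw.continuous_uncurry_flow s).comp
      (continuous_const.prodMk continuous_id : Continuous fun y : E => (t, y)))
  refine abs_mollify_sub_mollify_le ρ (hc s') (hc s) fun y hy => ?_
  rw [← hw.flow_flow h1 h2, ← Real.dist_eq, dist_comm]
  refine (hψ.dist_le_mul _ _).trans ?_
  rw [mul_assoc, dist_eq_norm]
  refine mul_le_mul_of_nonneg_left ((hw.norm_flow_sub_flow_le _ _ _ _).trans ?_) K.2
  refine mul_le_mul_of_nonneg_left ?_ (by positivity)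
  rw [add_sub_right_comm]
  exact hw.norm_flow_sub_frozen_le h1 hy

theorem lipschitzWith_comp_flow (hw : LipField w g) {ψ : E → ℝ} {K : ℝ≥0}
    (hψ : LipschitzWith K ψ) (s t : ℝ) :
    LipschitzWith (K * (2 * Real.exp (2 * ∫ r, g r)).toNNReal) fun y => ψ (hw.flow s t y) := by
  refine hψ.comp (LipschitzWith.of_dist_le_mul fun x y => ?_)
  rw [dist_eq_norm, dist_eq_norm, Real.coe_toNNReal _ (by positivity)]
  exact hw.norm_flow_sub_flow_le s t x y

end LipField

open LipField (frozen)

variable {v w : ℝ → E → E} {μ : ℝ → ProbabilityMeasure E} {g : ℝ → ℝ}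

theorem abs_mul_fderiv_sub_le (hw : LipField w g) {χ f : E → ℝ} {κ M C : ℝ}
    (hχ : ContDiff ℝ ∞ χ) (hχ1 : ∀ x, |χ x| ≤ 1) (hκ : ∀ x, ‖fderiv ℝ χ x‖ ≤ κ)
    (hM : ∀ x, ‖fderiv ℝ f x‖ ≤ M) (hC : ∀ x y, ‖fderiv ℝ f x - fderiv ℝ f y‖ ≤ C * ‖x - y‖)
    (r : ℝ) (x y : E) :
    |χ x * fderiv ℝ f x (w r x) - χ y * fderiv ℝ f y (w r y)| ≤
      (κ * M + C + M) * g r * ‖x - y‖ := by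
  have hg := hw.nonneg r
  have hM0 : 0 ≤ M := (norm_nonneg _).trans (hM x)
  have h1 : |χ x - χ y| ≤ κ * ‖x - y‖ := by
    have := convex_univ.norm_image_sub_le_of_norm_fderiv_le (𝕜 := ℝ) (f := χ)
      (fun z _ => (hχ.differentiable (by simp)) z) (fun z _ => hκ z) (mem_univ y) (mem_univ x)
    rwa [Real.norm_eq_abs] at this
  have h2 : |fderiv ℝ f x (w r x)| ≤ M * g r :=
    ((fderiv ℝ f x).le_opNorm _).trans (mul_le_mul (hM x) (hw.norm_le r x) (norm_nonneg _) hM0)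
  have h3 : |(fderiv ℝ f x - fderiv ℝ f y) (w r x)| ≤ C * ‖x - y‖ * g r :=
    (ContinuousLinearMap.le_opNorm _ _).trans (mul_le_mul (hC x y) (hw.norm_le r x)
      (norm_nonneg _) ((norm_nonneg _).trans (hC x y)))
  have h4 : |fderiv ℝ f y (w r x - w r y)| ≤ M * (g r * ‖x - y‖) :=
    ((fderiv ℝ f y).le_opNorm _).trans (mul_le_mul (hM y) (hw.lip r x y) (norm_nonneg _) hM0)
  have h5 : χ x * fderiv ℝ f x (w r x) - χ y * fderiv ℝ f y (w r y) =
      (χ x - χ y) * fderiv ℝ f x (w r x) + χ y * ((fderiv ℝ f x - fderiv ℝ f y) (w r x)) +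
        χ y * fderiv ℝ f y (w r x - w r y) := by
    rw [map_sub, sub_apply]
    ring
  rw [h5]
  refine (abs_add_three _ _ _).trans ?_
  rw [abs_mul, abs_mul, abs_mul]
  have h6 := mul_le_mul h1 h2 (abs_nonneg _) ((abs_nonneg _).trans h1)
  have h7 := mul_le_mul (hχ1 y) h3 (abs_nonneg _) zero_le_one
  have h8 := mul_le_mul (hχ1 y) h4 (abs_nonneg _) zero_le_one
  linarith

namespace WeakSolution

/-- Transport of a smooth function `f` along the frozen displacement, over a time interval
`[s, s']`. The first error term comes from the cutoff `χ`; the others are quadratic in the integrals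
over the interval. -/
theorem abs_integral_sub_integral_frozen_le (h : WeakSolution v μ) (hw : LipField w g)
    {χ f : E → ℝ} {Ψ κ M C : ℝ} (hχ : ContDiff ℝ ∞ χ) (hχc : HasCompactSupport χ)
    (hχ1 : ∀ x, |χ x| ≤ 1) (hκ : ∀ x, ‖fderiv ℝ χ x‖ ≤ κ) (hf : ContDiff ℝ ∞ f)
    (hΨ : ∀ x, |f x| ≤ Ψ) (hM : ∀ x, ‖fderiv ℝ f x‖ ≤ M)
    (hC : ∀ x y, ‖fderiv ℝ f x - fderiv ℝ f y‖ ≤ C * ‖x - y‖) (hC0 : 0 ≤ C)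
    {s s' : ℝ} (hs : 0 ≤ s) (hss : s ≤ s')
    (hvw : ∀ᵐ r, r ∈ Ioc s s' → ∀ x, χ x ≠ 0 → w r x = v r x) :
    |(∫ x, f x * χ x ∂(μ s' : Measure E)) -
        ∫ x, f (x + frozen w s s' x) * χ x ∂(μ s : Measure E)| ≤
      Ψ * κ * (∫ r in s..s', speed v μ r) + C * (∫ r in s..s', g r) ^ 2 +
        (κ * M + C + M) * (∫ r in s..s', g r) * ∫ r in s..s', speed v μ r := by
  set γ := ∫ r in s..s', g r with hγ
  set N := ∫ r in s..s', speed v μ r with hN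
  have hM0 : 0 ≤ M := (norm_nonneg _).trans (hM 0)
  have hκ0 : 0 ≤ κ := (norm_nonneg _).trans (hκ 0)
  have hΨ0 : 0 ≤ Ψ := (abs_nonneg _).trans (hΨ 0)
  have hfd := hf.differentiable (by simp)
  have hχd := hχ.differentiable (by simp)
  have hDf : Continuous (fderiv ℝ f) := hf.continuous_fderiv (by simp)
  have hDχ : Continuous (fderiv ℝ χ) := hχ.continuous_fderiv (by simp)
  set H : ℝ → E → ℝ := fun r x => χ x * fderiv ℝ f x (w r x) with hH
  have hHm : Measurable fun p : ℝ × E => H p.1 p.2 :=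
    (hχ.continuous.measurable.comp measurable_snd).mul
      (measurable_clm_apply ((hDf.comp continuous_snd).stronglyMeasurable) hw.measurable)
  have hHb : ∀ r x, ‖H r x‖ ≤ M * g r := fun r x => by
    rw [hH, norm_mul, ← one_mul (M * g r)]
    exact mul_le_mul (hχ1 x) (((fderiv ℝ f x).le_opNorm _).trans
      (mul_le_mul (hM x) (hw.norm_le r x) (norm_nonneg _) hM0)) (norm_nonneg _) zero_le_one
  have hHint : Integrable (fun p : ℝ × E => H p.1 p.2)
      ((volume.restrict (Ioc s s')).prod (μ s : Measure E)) :=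
    ((hw.integrable.restrict (s := Ioc s s')).const_mul M |>.comp_fst (μ s : Measure E)).mono'
      hHm.aestronglyMeasurable (Eventually.of_forall fun p => hHb p.1 p.2)
  have hHI : IntervalIntegrable (fun r => ∫ x, H r x ∂(μ s : Measure E)) volume s s' :=
    (intervalIntegrable_iff_integrableOn_Ioc_of_le hss).mpr hHint.integral_prod_left
  have hfχ := hf.mul hχ
  have hfχc : HasCompactSupport fun x => f x * χ x := hχc.mul_left
  -- The first-order term of the displacement is the time integral of `H` against `μ s`.
  have hswap : ∫ r in s..s', ∫ x, H r x ∂(μ s : Measure E) =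
      ∫ x, fderiv ℝ f x (frozen w s s' x) * χ x ∂(μ s : Measure E) := by
    rw [intervalIntegral.integral_of_le hss, integral_integral_swap hHint]
    refine integral_congr_ae (Eventually.of_forall fun x => ?_)
    simp only [hH]
    rw [integral_const_mul, ← intervalIntegral.integral_of_le hss,
      (fderiv ℝ f x).intervalIntegral_comp_comm (hw.intervalIntegrable_const s s' x), mul_comm,
      frozen]
  have hA : |((∫ x, f x * χ x ∂(μ s' : Measure E)) - ∫ x, f x * χ x ∂(μ s : Measure E)) -
      ∫ r in s..s', ∫ x, H r x ∂(μ s : Measure E)| ≤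
      Ψ * κ * N + (κ * M + C + M) * γ * N := by
    rw [h.integral_sub_integral_eq hfχ hfχc hs hss, ← intervalIntegral.integral_sub
      (h.intervalIntegrable_fderiv_apply hfχ hfχc hs (hs.trans hss)) hHI, ← Real.norm_eq_abs]
    have hI1 := (h.intervalIntegrable_speed hs (hs.trans hss)).const_mul (Ψ * κ)
    have hI2 : IntervalIntegrable (fun r => (κ * M + C + M) * N * g r) volume s s' :=
      hw.integrable.intervalIntegrable.const_mul _
    have hR : ∫ r in s..s', (Ψ * κ * speed v μ r + (κ * M + C + M) * N * g r) =
        Ψ * κ * N + (κ * M + C + M) * γ * N := by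
      rw [intervalIntegral.integral_add hI1 hI2, intervalIntegral.integral_const_mul,
        intervalIntegral.integral_const_mul]
      ring
    rw [← hR]
    refine intervalIntegral.norm_integral_le_of_norm_le hss ?_ (hI1.add hI2)
    filter_upwards [h.ae_integrable, hvw] with r hr hvwr hrs
    have hvr := hr (hs.trans hrs.1.le)
    have e1 : ∀ x, fderiv ℝ (fun x => f x * χ x) x (v r x) =
        f x * fderiv ℝ χ x (v r x) + H r x := fun x => by
      rw [fderiv_fun_mul (hfd x) (hχd x)]
      simp only [add_apply, smul_apply, smul_eq_mul, hH]
      by_cases hx : χ x = 0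
      · simp [hx]
      · rw [hvwr hrs x hx]
    have i1 : Integrable (fun x => f x * fderiv ℝ χ x (v r x)) (μ r : Measure E) :=
      (h.integrable_clm hvr hDχ hκ).bdd_mul hf.continuous.aestronglyMeasurable
        (Eventually.of_forall hΨ)
    have i2 : Integrable (fun x => H r x) (μ r : Measure E) :=
      Integrable.of_bound (hHm.comp measurable_prodMk_left).aestronglyMeasurable (M * g r)
        (Eventually.of_forall (hHb r))
    have b1 : ‖∫ x, f x * fderiv ℝ χ x (v r x) ∂(μ r : Measure E)‖ ≤ Ψ * κ * speed v μ r := by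
      rw [speed, ← integral_const_mul]
      refine norm_integral_le_of_norm_le (hvr.norm.const_mul _) (Eventually.of_forall fun x => ?_)
      rw [norm_mul, mul_assoc]
      exact mul_le_mul (hΨ x) ((fderiv ℝ χ x).le_of_opNorm_le (hκ x) _) (norm_nonneg _) hΨ0
    have b2 : |(∫ x, H r x ∂(μ r : Measure E)) - ∫ x, H r x ∂(μ s : Measure E)| ≤
        (κ * M + C + M) * N * g r := by
      have hL0 : 0 ≤ (κ * M + C + M) * g r := mul_nonneg (by positivity) (hw.nonneg r)
      have hL : LipschitzWith ((κ * M + C + M) * g r).toNNReal (H r) :=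
        LipschitzWith.of_dist_le_mul fun x y => by
          rw [Real.dist_eq, Real.coe_toNNReal _ hL0, dist_eq_norm]
          exact abs_mul_fderiv_sub_le hw hχ hχ1 hκ hM hC r x y
      refine (h.abs_integral_sub_integral_le hL hχc.mul_right hs hrs.1.le).trans ?_
      rw [Real.coe_toNNReal _ hL0]
      have : ∫ q in s..r, speed v μ q ≤ N :=
        intervalIntegral.integral_mono_interval le_rfl hrs.1.le hrs.2
          (Eventually.of_forall (speed_nonneg v μ)) (h.intervalIntegrable_speed hs (hs.trans hss))
      have := mul_le_mul_of_nonneg_left this hL0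
      linarith
    simp only [e1]
    rw [integral_add i1 i2, add_sub_assoc]
    exact (norm_add_le _ _).trans (add_le_add b1 b2)
  have hbm := hw.measurable_frozen hss
  have j1 : Integrable (fun x => f x * χ x) (μ s : Measure E) :=
    hfχ.continuous.integrable_of_hasCompactSupport hfχc
  have j2 : Integrable (fun x => f (x + frozen w s s' x) * χ x) (μ s : Measure E) := by
    refine Integrable.of_bound (((hf.continuous.measurable.comp (measurable_id.add hbm)).mul
      hχ.continuous.measurable).aestronglyMeasurable) (Ψ * 1) (Eventually.of_forall fun x => ?_)
    rw [norm_mul]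
    exact mul_le_mul (hΨ _) (hχ1 x) (norm_nonneg _) hΨ0
  have j3 : Integrable (fun x => fderiv ℝ f x (frozen w s s' x) * χ x) (μ s : Measure E) := by
    refine Integrable.of_bound (((measurable_clm_apply hDf.stronglyMeasurable hbm).mul
      hχ.continuous.measurable).aestronglyMeasurable) (M * γ * 1)
      (Eventually.of_forall fun x => ?_)
    rw [norm_mul]
    have h1 : ‖fderiv ℝ f x (frozen w s s' x)‖ ≤ M * γ := ((fderiv ℝ f x).le_opNorm _).trans
      (mul_le_mul (hM x) (hw.norm_frozen_le hss x) (norm_nonneg _) hM0)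
    exact mul_le_mul h1 (hχ1 x) (norm_nonneg _) ((norm_nonneg _).trans h1)
  have hB : |((∫ x, f (x + frozen w s s' x) * χ x ∂(μ s : Measure E)) -
      ∫ x, f x * χ x ∂(μ s : Measure E)) - ∫ r in s..s', ∫ x, H r x ∂(μ s : Measure E)| ≤
      C * γ ^ 2 := by
    have j21 : Integrable (fun x => f (x + frozen w s s' x) * χ x - f x * χ x)
      (μ s : Measure E) := j2.sub j1
    rw [hswap, ← integral_sub j2 j1, ← integral_sub j21 j3]
    refine abs_integral_le (fun x => ?_) s
    rw [← sub_mul, ← sub_mul, norm_mul, ← mul_one (C * γ ^ 2)]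
    refine mul_le_mul ((abs_taylor_le hfd hC hC0 x _).trans (mul_le_mul_of_nonneg_left ?_ hC0))
      (hχ1 x) (norm_nonneg _) (by positivity)
    exact pow_le_pow_left₀ (norm_nonneg _) (hw.norm_frozen_le hss x) 2
  have hA' := abs_le.mp hA
  have hB' := abs_le.mp hB
  rw [abs_le]
  constructor <;> linarith [hA'.1, hA'.2, hB'.1, hB'.2]

/-- The weak solution is close to the image of the initial measure under the flow of a globally
Lipschitz field `w` that agrees with `v` on the support of a cutoff function `χ`. The error is
controlled by the gradient of `χ`. The backward transport equation for `w` is solved by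
`ψ ∘ flow s t`, which is only Lipschitz in space: it is mollified at a scale `ρ.rOut` that tends to
zero after the sum over the time steps has been taken. -/
theorem abs_integral_sub_integral_flow_le (h : WeakSolution v μ) (hw : LipField w g)
    {χ ψ : E → ℝ} {Ψ κ : ℝ} {K : ℝ≥0} (hχ : ContDiff ℝ ∞ χ) (hχc : HasCompactSupport χ)
    (hχ1 : ∀ x, |χ x| ≤ 1) (hκ : ∀ x, ‖fderiv ℝ χ x‖ ≤ κ) (hψ : LipschitzWith K ψ)
    (hΨ : ∀ x, |ψ x| ≤ Ψ) {t : ℝ} (ht : 0 ≤ t)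
    (hvw : ∀ᵐ r, r ∈ Ioc 0 t → ∀ x, χ x ≠ 0 → w r x = v r x) :
    |(∫ x, ψ x * χ x ∂(μ t : Measure E)) -
        ∫ x, ψ (hw.flow 0 t x) * χ x ∂(μ 0 : Measure E)| ≤
      Ψ * κ * ∫ r in (0 : ℝ)..t, speed v μ r := by
  set M : ℝ≥0 := K * (2 * Real.exp (2 * ∫ r, g r)).toNNReal with hM
  have hMc : (M : ℝ) = K * (2 * Real.exp (2 * ∫ r, g r)) := by
    rw [hM, NNReal.coe_mul, Real.coe_toNNReal _ (by positivity)]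
  set φ : ℝ → E → ℝ := fun s y => ψ (hw.flow s t y) with hφ
  have hφL : ∀ s, LipschitzWith M (φ s) := fun s => hw.lipschitzWith_comp_flow hψ s t
  have hφΨ : ∀ s x, |φ s x| ≤ Ψ := fun s x => hΨ _
  have hκ0 : 0 ≤ κ := (norm_nonneg _).trans (hκ 0)
  have hg0 : 0 ≤ ∫ r in (0 : ℝ)..t, g r :=
    intervalIntegral.integral_nonneg ht fun r _ => hw.nonneg r
  have key : ∀ ρ : ContDiffBump (0 : E),
      |(∫ x, mollify ρ (φ t) x * χ x ∂(μ t : Measure E)) -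
        ∫ x, mollify ρ (φ 0) x * χ x ∂(μ 0 : Measure E)| ≤
      Ψ * κ * (∫ r in (0 : ℝ)..t, speed v μ r) + M * ρ.rOut * ∫ r in (0 : ℝ)..t, g r := by
    intro ρ
    obtain ⟨C, hC0, hC⟩ := exists_norm_fderiv_mollify_sub_le ρ
    have hIs := (h.intervalIntegrable_speed le_rfl ht).const_mul (Ψ * κ)
    have hIg : IntervalIntegrable (fun r => M * ρ.rOut * g r) volume 0 t :=
      hw.integrable.intervalIntegrable.const_mul _
    have hR : ∀ s s', 0 ≤ s → 0 ≤ s' → ∫ r in s..s', (Ψ * κ * speed v μ r + M * ρ.rOut * g r) =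
        Ψ * κ * (∫ r in s..s', speed v μ r) + M * ρ.rOut * ∫ r in s..s', g r :=
      fun s s' hs hs' => by
      rw [intervalIntegral.integral_add ((h.intervalIntegrable_speed hs hs').const_mul _)
        (hw.integrable.intervalIntegrable.const_mul _), intervalIntegral.integral_const_mul,
        intervalIntegral.integral_const_mul]
    rw [← hR 0 t le_rfl ht]
    refine abs_sub_le_integral_of_quadratic_error
      (F := fun s => ∫ x, mollify ρ (φ s) x * χ x ∂(μ s : Measure E))
      (h := fun r => g r + speed v μ r) (C := C * M + (κ * M + C * M + M) + M) ht (hIs.add hIg)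
      (hw.integrable.intervalIntegrable.add (h.intervalIntegrable_speed le_rfl ht))
      (fun r => add_nonneg (hw.nonneg r) (speed_nonneg v μ r)) (by positivity)
      fun s s' hs hss hst => ?_
    have hvw' : ∀ᵐ r, r ∈ Ioc s s' → ∀ x, χ x ≠ 0 → w r x = v r x := by
      filter_upwards [hvw] with r hr hrs
      exact hr ⟨lt_of_le_of_lt hs hrs.1, hrs.2.trans hst⟩
    have h1 := h.abs_integral_sub_integral_frozen_le hw (f := mollify ρ (φ s')) (M := M)
      (C := C * M) hχ hχc hχ1 hκ (contDiff_mollify ρ (hφL s').continuous)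
      (abs_mollify_le ρ (hφL s').continuous (hφΨ s'))
      (fun x => norm_fderiv_le_of_lipschitz ℝ (lipschitzWith_mollify ρ (hφL s')))
      (hC M _ (hφL s')) (by positivity) hs hss hvw'
    have hsm : ∀ s, Continuous (mollify ρ (φ s)) := fun s =>
      (contDiff_mollify ρ (hφL s).continuous).continuous
    have j1 : Integrable (fun x => mollify ρ (φ s') (x + frozen w s s' x) * χ x)
        (μ s : Measure E) := by
      refine Integrable.of_bound ((((hsm s').measurable.comp
        (measurable_id.add (hw.measurable_frozen hss))).mul
        hχ.continuous.measurable).aestronglyMeasurable) (Ψ * 1) (Eventually.of_forall fun x => ?_)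
      rw [norm_mul]
      exact mul_le_mul (abs_mollify_le ρ (hφL s').continuous (hφΨ s') _) (hχ1 x) (norm_nonneg _)
        ((abs_nonneg _).trans (hφΨ s' x))
    have j2 : Integrable (fun x => mollify ρ (φ s) x * χ x) (μ s : Measure E) :=
      ((hsm s).mul hχ.continuous).integrable_of_hasCompactSupport hχc.mul_left
    have h2 : |(∫ x, mollify ρ (φ s') (x + frozen w s s' x) * χ x ∂(μ s : Measure E)) -
        ∫ x, mollify ρ (φ s) x * χ x ∂(μ s : Measure E)| ≤
        M * ((∫ r in s..s', g r) * ((∫ r in s..s', g r) + ρ.rOut)) := by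
      rw [← integral_sub j1 j2]
      refine abs_integral_le (fun x => ?_) s
      have h3 := hw.abs_mollify_flow_sub_le ρ hψ hss hst x
      rw [← hMc] at h3
      rw [← sub_mul, norm_mul, Real.norm_eq_abs]
      exact (mul_le_of_le_one_right (abs_nonneg _) (hχ1 x)).trans h3
    have hγ : 0 ≤ ∫ r in s..s', g r := intervalIntegral.integral_nonneg hss fun r _ => hw.nonneg r
    have hN : 0 ≤ ∫ r in s..s', speed v μ r :=
      intervalIntegral.integral_nonneg hss fun r _ => speed_nonneg v μ r
    rw [hR s s' hs (hs.trans hss), intervalIntegral.integral_add hw.integrable.intervalIntegrable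
      (h.intervalIntegrable_speed hs (hs.trans hss))]
    refine (abs_sub_le _ (∫ x, mollify ρ (φ s') (x + frozen w s s' x) * χ x
      ∂(μ s : Measure E)) _).trans ((add_le_add h1 h2).trans ?_)
    generalize (∫ r in s..s', g r) = γ at hγ ⊢
    generalize (∫ r in s..s', speed v μ r) = N at hN ⊢
    have e1 : γ ^ 2 ≤ (γ + N) ^ 2 := pow_le_pow_left₀ hγ (by linarith) 2
    have e2 : γ * N ≤ (γ + N) ^ 2 := by nlinarith
    have e3 := mul_le_mul_of_nonneg_left e1 (mul_nonneg hC0 M.2)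
    have e4 := mul_le_mul_of_nonneg_left e1 M.2
    have e5 := mul_le_mul_of_nonneg_left e2
      (show 0 ≤ κ * M + C * M + M by have := M.2; positivity)
    have e6 : (M : ℝ) * (γ * (γ + ρ.rOut)) = M * γ ^ 2 + M * ρ.rOut * γ := by ring
    have e7 : (κ * M + C * M + M) * γ * N = (κ * M + C * M + M) * (γ * N) := by ring
    simp only [NNReal.val_eq_coe] at e3 e4
    rw [e6, e7]
    linarith
  -- The mollification radius tends to zero.
  refine le_of_forall_pos_le_add fun ε hε => ?_
  obtain ⟨ρ, hρ⟩ : ∃ ρ : ContDiffBump (0 : E),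
      M * ρ.rOut * (∫ r in (0 : ℝ)..t, g r) + 2 * (M * ρ.rOut) ≤ ε := by
    set A := M * ((∫ r in (0 : ℝ)..t, g r) + 2) + 1 with hA
    have hA0 : 0 < A := by positivity
    refine ⟨⟨ε / A / 2, ε / A, by positivity, by
      have : 0 < ε / A := by positivity
      linarith⟩, ?_⟩
    change M * (ε / A) * (∫ r in (0 : ℝ)..t, g r) + 2 * (M * (ε / A)) ≤ ε
    have : M * (ε / A) * (∫ r in (0 : ℝ)..t, g r) + 2 * (M * (ε / A)) = (A - 1) * (ε / A) := by
      rw [hA]; ring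
    rw [this, sub_mul, mul_div_cancel₀ _ hA0.ne']
    have : 0 < ε / A := by positivity
    linarith
  have hmol : ∀ s, |(∫ x, mollify ρ (φ s) x * χ x ∂(μ s : Measure E)) -
      ∫ x, φ s x * χ x ∂(μ s : Measure E)| ≤ M * ρ.rOut := fun s => by
    have hi : ∀ f : E → ℝ, Continuous f → Integrable (fun x => f x * χ x) (μ s : Measure E) :=
      fun f hf => (hf.mul hχ.continuous).integrable_of_hasCompactSupport hχc.mul_left
    rw [← integral_sub (hi _ (contDiff_mollify ρ (hφL s).continuous).continuous)
      (hi _ (hφL s).continuous)]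
    refine abs_integral_le (fun x => ?_) s
    rw [← sub_mul, norm_mul, Real.norm_eq_abs]
    exact (mul_le_of_le_one_right (abs_nonneg _) (hχ1 x)).trans (abs_mollify_sub_le ρ (hφL s) x)
  have ht' : φ t = ψ := by
    funext x
    rw [hφ]
    simp only
    rw [hw.flow_of_le le_rfl]
  have h1 := abs_le.mp (key ρ)
  have h2 := abs_le.mp (hmol t)
  have h3 := abs_le.mp (hmol 0)
  rw [ht'] at h1 h2
  rw [abs_le]
  constructor <;> linarith [h1.1, h1.2, h2.1, h2.2, h3.1, h3.2]

end WeakSolution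

end Comparison

/-! ### Cutoff functions and truncated fields -/

section Cutoff

variable {E : Type*} [NormedAddCommGroup E] [InnerProductSpace ℝ E] [FiniteDimensional ℝ E]

theorem exists_cutoff : ∃ c : ℝ≥0, ∀ R : ℝ, 0 < R → ∃ χ : E → ℝ, ContDiff ℝ ∞ χ ∧
    HasCompactSupport χ ∧ (∀ x, χ x ∈ Icc (0 : ℝ) 1) ∧ (∀ x, ‖x‖ ≤ R → χ x = 1) ∧
    (∀ x, 2 * R ≤ ‖x‖ → χ x = 0) ∧ LipschitzWith (c * R⁻¹.toNNReal) χ := by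
  let b : ContDiffBump (0 : E) := ⟨1, 2, one_pos, one_lt_two⟩
  obtain ⟨c, hc⟩ := (b.contDiff (n := 1)).lipschitzWith_of_hasCompactSupport b.hasCompactSupport
    (by norm_num)
  refine ⟨c, fun R hR => ⟨fun x => b (R⁻¹ • x), b.contDiff.comp (by fun_prop), ?_,
    fun x => ⟨b.nonneg, b.le_one⟩, fun x hx => ?_, fun x hx => ?_, ?_⟩⟩
  · exact b.hasCompactSupport.comp_smul (inv_ne_zero hR.ne')
  · refine b.one_of_mem_closedBall ?_
    rw [mem_closedBall_zero_iff, norm_smul, Real.norm_eq_abs, abs_of_pos (inv_pos.mpr hR),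
      inv_mul_le_iff₀ hR]
    change ‖x‖ ≤ R * 1
    linarith
  · refine b.zero_of_le_dist ?_
    rw [dist_zero_right, norm_smul, Real.norm_eq_abs, abs_of_pos (inv_pos.mpr hR),
      le_inv_mul_iff₀ hR]
    change R * 2 ≤ ‖x‖
    linarith
  · refine hc.comp (LipschitzWith.of_dist_le_mul fun x y => ?_)
    rw [dist_smul₀, Real.norm_eq_abs, abs_of_pos (inv_pos.mpr hR),
      Real.coe_toNNReal _ (inv_pos.mpr hR).le]

variable [MeasurableSpace E] [BorelSpace E]

/-- A field with locally integrable bounds and Lipschitz constants on a large ball agrees on a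
smaller ball, up to a finite time and for almost every time, with a globally Lipschitz field. -/
theorem exists_lipField_eq {v : ℝ → E → E} (hv : Measurable (fun p : ℝ × E => v p.1 p.2))
    {R : ℝ} (hR : 0 < R) (T : ℝ) {B L : ℝ → ℝ≥0}
    (hBL : LocallyIntegrableOn (fun t => (B t : ℝ) + (L t : ℝ)) (Ici 0) volume)
    (h : ∀ᵐ t ∂(volume.restrict (Ici (0 : ℝ))),
      (∀ x ∈ Metric.closedBall (0 : E) (2 * R), ‖v t x‖ ≤ B t) ∧
        LipschitzOnWith (L t) (v t) (Metric.closedBall (0 : E) (2 * R))) :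
    ∃ w : ℝ → E → E, ∃ g : ℝ → ℝ, LipField w g ∧
      ∀ᵐ t, t ∈ Icc 0 T → ∀ x, ‖x‖ ≤ R → w t x = v t x := by
  obtain ⟨c, hc⟩ := exists_cutoff (E := E)
  obtain ⟨χ, hχs, -, hχ01, hχ1, hχ0, hχL⟩ := hc R hR
  set c' : ℝ≥0 := c * R⁻¹.toNNReal
  have h' := (ae_restrict_iff' measurableSet_Ici).mp h
  obtain ⟨N, hNsub, hNm, hN0⟩ := exists_measurable_superset_of_null (ae_iff.mp h')
  set S := Icc 0 T \ N with hS
  have hSm : MeasurableSet S := measurableSet_Icc.diff hNm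
  have hSP : ∀ t ∈ S, (∀ x ∈ Metric.closedBall (0 : E) (2 * R), ‖v t x‖ ≤ B t) ∧
      LipschitzOnWith (L t) (v t) (Metric.closedBall (0 : E) (2 * R)) := fun t ht => by
    by_contra hcon
    exact ht.2 (hNsub fun hP => hcon (hP ht.1.1))
  classical
  refine ⟨fun t x => if t ∈ S then χ x • v t x else 0,
    S.indicator fun t => (1 + c') * ((B t : ℝ) + L t), ⟨?_, ?_, ?_, ?_⟩, ?_⟩
  · exact Measurable.ite (measurable_fst hSm)
      ((hχs.continuous.measurable.comp measurable_snd).smul hv) measurable_const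
  · rw [integrable_indicator_iff hSm]
    refine IntegrableOn.mono_set ?_ (sdiff_subset : S ⊆ Icc 0 T)
    exact (hBL.integrableOn_compact_subset Icc_subset_Ici_self isCompact_Icc).const_mul _
  · intro t x
    by_cases ht : t ∈ S
    · simp only [if_pos ht, indicator_of_mem ht]
      have hB := (B t).2
      have hL := (L t).2
      have hc0 := c'.2
      have hbd : ‖χ x • v t x‖ ≤ B t := by
        rcases le_or_gt (2 * R) ‖x‖ with hx | hx
        · rw [hχ0 x hx, zero_smul, norm_zero]; exact hB
        · rw [norm_smul, Real.norm_eq_abs, abs_of_nonneg (hχ01 x).1]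
          exact (mul_le_of_le_one_left (norm_nonneg _) (hχ01 x).2).trans
            ((hSP t ht).1 x (by simpa using hx.le))
      refine hbd.trans ?_
      simp only [NNReal.val_eq_coe] at *
      nlinarith
    · simp [ht]
  · intro t x y
    by_cases ht : t ∈ S
    · simp only [if_pos ht, indicator_of_mem ht]
      obtain ⟨h1, h2⟩ := hSP t ht
      -- The case where `y` is the point closer to the origin is symmetric.
      wlog hxy : ‖x‖ ≤ ‖y‖ generalizing x y
      · rw [norm_sub_rev, norm_sub_rev x]
        exact this y x (le_of_not_ge hxy)
      rcases le_or_gt (2 * R) ‖x‖ with hx | hx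
      · rw [hχ0 x hx, hχ0 y (hx.trans hxy), zero_smul, zero_smul, sub_zero, norm_zero]
        positivity
      have hxB := h1 x (by simpa using hx.le)
      have hχxy : |χ x - χ y| ≤ c' * ‖x - y‖ := by
        have := hχL.dist_le_mul x y
        rwa [Real.dist_eq, dist_eq_norm] at this
      have e1 : ‖(χ x - χ y) • v t x‖ ≤ c' * ‖x - y‖ * B t := by
        rw [norm_smul, Real.norm_eq_abs]
        exact mul_le_mul hχxy hxB (norm_nonneg _) (by positivity)
      have e2 : ‖χ y • (v t x - v t y)‖ ≤ L t * ‖x - y‖ := by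
        rcases le_or_gt (2 * R) ‖y‖ with hy | hy
        · rw [hχ0 y hy, zero_smul, norm_zero]; positivity
        · rw [norm_smul, Real.norm_eq_abs, abs_of_nonneg (hχ01 y).1]
          refine (mul_le_of_le_one_left (norm_nonneg _) (hχ01 y).2).trans ?_
          have := h2.dist_le_mul x (by simpa using hx.le) y (by simpa using hy.le)
          rwa [dist_eq_norm, dist_eq_norm] at this
      have e3 : χ x • v t x - χ y • v t y = (χ x - χ y) • v t x + χ y • (v t x - v t y) := by
        rw [sub_smul, smul_sub]
        abel
      rw [e3]
      refine (norm_add_le _ _).trans ((add_le_add e1 e2).trans ?_)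
      have p1 : (0 : ℝ) ≤ B t * ‖x - y‖ := by positivity
      have p2 : (0 : ℝ) ≤ c' * (L t * ‖x - y‖) := by positivity
      linarith
    · simp [ht]
  · have hN : ∀ᵐ t, t ∉ N := measure_eq_zero_iff_ae_notMem.mp hN0
    filter_upwards [hN] with t htN ht x hx
    rw [if_pos (show t ∈ S from ⟨ht, htN⟩), hχ1 x hx, one_smul]

end Cutoff

/-! ### Exhaustion by truncated flows -/

section Exhaustion

set_option linter.unusedSectionVars false

variable {E : Type*} [NormedAddCommGroup E] [InnerProductSpace ℝ E] [FiniteDimensional ℝ E]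
  [MeasurableSpace E] [BorelSpace E]

/-- Globally Lipschitz fields `w n` that agree with `v` on the ball of radius `2 * (n + 1)` at
almost every time of `[0, n]`. -/
structure Exhaustion (v : ℝ → E → E) (w : ℕ → ℝ → E → E) (g : ℕ → ℝ → ℝ) : Prop where
  lipField : ∀ n, LipField (w n) (g n)
  eq : ∀ n : ℕ, ∀ᵐ t, t ∈ Icc (0 : ℝ) n → ∀ x, ‖x‖ ≤ 2 * (n + 1) → w n t x = v t x

namespace Exhaustion

variable {v : ℝ → E → E} {w : ℕ → ℝ → E → E} {g : ℕ → ℝ → ℝ} {μ : ℝ → ProbabilityMeasure E}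

/-- The flow from time `0` of the `n`-th truncated field. -/
noncomputable def y (hX : Exhaustion v w g) (n : ℕ) (t : ℝ) (x : E) : E :=
  (hX.lipField n).flow 0 t x

theorem continuous_uncurry_y (hX : Exhaustion v w g) (n : ℕ) :
    Continuous fun p : ℝ × E => hX.y n p.1 p.2 :=
  (hX.lipField n).continuous_uncurry_flow 0

theorem continuous_y_left (hX : Exhaustion v w g) (n : ℕ) (x : E) :
    Continuous fun t => hX.y n t x :=
  (hX.lipField n).continuous_flow 0 x

theorem continuous_y (hX : Exhaustion v w g) (n : ℕ) (t : ℝ) : Continuous (hX.y n t) :=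
  (hX.continuous_uncurry_y n).comp (continuous_const.prodMk continuous_id)

theorem y_zero (hX : Exhaustion v w g) (n : ℕ) (x : E) : hX.y n 0 x = x :=
  (hX.lipField n).flow_of_le le_rfl x

theorem tendsto_integral_comp_y (hX : Exhaustion v w g) (h : WeakSolution v μ) {t : ℝ} (ht : 0 ≤ t)
    {ψ : E → ℝ} {K : ℝ≥0} (hψ : LipschitzWith K ψ) {Ψ : ℝ} (hΨ : ∀ x, |ψ x| ≤ Ψ) :
    Tendsto (fun n => ∫ x, ψ (hX.y n t x) ∂(μ 0 : Measure E)) atTop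
      (𝓝 (∫ x, ψ x ∂(μ t : Measure E))) := by
  obtain ⟨c, hc⟩ := exists_cutoff (E := E)
  choose χ hχs hχc hχ01 hχ1 hχ0 hχL using fun n : ℕ => hc ((n : ℝ) + 1) (by positivity)
  have hΨ0 : 0 ≤ Ψ := (abs_nonneg _).trans (hΨ 0)
  have hχabs : ∀ n x, |χ n x| ≤ 1 := fun n x => by
    rw [abs_of_nonneg (hχ01 n x).1]; exact (hχ01 n x).2
  have hχt : ∀ x, ∀ᶠ n in atTop, χ n x = 1 := fun x => by
    obtain ⟨N, hN⟩ := exists_nat_ge ‖x‖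
    filter_upwards [eventually_ge_atTop N] with n hn
    refine hχ1 n x (hN.trans ?_)
    have : (N : ℝ) ≤ n := by exact_mod_cast hn
    linarith
  have hδ : Tendsto (fun n : ℕ => 1 / ((n : ℝ) + 1)) atTop (𝓝 0) :=
    tendsto_one_div_add_atTop_nhds_zero_nat
  -- The transported and the actual integrals of the truncated test functions get close.
  have h1 : Tendsto (fun n => (∫ x, ψ x * χ n x ∂(μ t : Measure E)) -
      ∫ x, ψ (hX.y n t x) * χ n x ∂(μ 0 : Measure E)) atTop (𝓝 0) := by
    have hb : Tendsto (fun n : ℕ => Ψ * (c * (1 / ((n : ℝ) + 1))) *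
        ∫ r in (0 : ℝ)..t, speed v μ r) atTop (𝓝 0) := by
      simpa using! ((hδ.const_mul (c : ℝ)).const_mul Ψ).mul_const
        (∫ r in (0 : ℝ)..t, speed v μ r)
    refine squeeze_zero_norm' ?_ hb
    obtain ⟨N, hN⟩ := exists_nat_ge t
    filter_upwards [eventually_ge_atTop N] with n hn
    have hn' : t ≤ n := hN.trans (by exact_mod_cast hn)
    refine h.abs_integral_sub_integral_flow_le (hX.lipField n) (hχs n) (hχc n) (hχabs n)
      (fun x => ?_) hψ hΨ ht ?_
    · have h2 := norm_fderiv_le_of_lipschitz ℝ (hχL n) (x₀ := x)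
      rwa [NNReal.coe_mul, Real.coe_toNNReal _ (by positivity), ← one_div] at h2
    · filter_upwards [hX.eq n] with r hr hrt x hx
      refine hr ⟨hrt.1.le, hrt.2.trans hn'⟩ x ?_
      by_contra hcon
      exact hx (hχ0 n x (le_of_not_ge hcon))
  have h2 : Tendsto (fun n => ∫ x, ψ x * χ n x ∂(μ t : Measure E)) atTop
      (𝓝 (∫ x, ψ x ∂(μ t : Measure E))) := by
    refine tendsto_integral_of_dominated_convergence (fun _ => Ψ)
      (fun n => (hψ.continuous.mul (hχs n).continuous).aestronglyMeasurable)
      (integrable_const _) (fun n => Eventually.of_forall fun x => ?_)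
      (Eventually.of_forall fun x => ?_)
    · rw [norm_mul]
      exact (mul_le_of_le_one_right (norm_nonneg _) (hχabs n x)).trans (hΨ x)
    · refine tendsto_const_nhds.congr' ?_
      filter_upwards [hχt x] with n hn
      rw [hn, mul_one]
  have h3 : Tendsto (fun n => ∫ x, ψ (hX.y n t x) * (1 - χ n x) ∂(μ 0 : Measure E)) atTop
      (𝓝 (∫ _, (0 : ℝ) ∂(μ 0 : Measure E))) := by
    refine tendsto_integral_of_dominated_convergence (fun _ => Ψ)
      (fun n => ((hψ.continuous.comp (hX.continuous_y n t)).mul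
        (continuous_const.sub (hχs n).continuous)).aestronglyMeasurable)
      (integrable_const _) (fun n => Eventually.of_forall fun x => ?_)
      (Eventually.of_forall fun x => ?_)
    · rw [norm_mul]
      refine (mul_le_of_le_one_right (norm_nonneg _) ?_).trans (hΨ _)
      rw [Real.norm_eq_abs, abs_le]
      constructor <;> linarith [(hχ01 n x).1, (hχ01 n x).2]
    · refine tendsto_const_nhds.congr' ?_
      filter_upwards [hχt x] with n hn
      rw [hn, sub_self, mul_zero]
  have h4 := (h2.sub h1).add h3
  rw [integral_zero, sub_zero, add_zero] at h4
  refine h4.congr fun n => ?_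
  have i1 : Integrable (fun x => ψ (hX.y n t x) * χ n x) (μ 0 : Measure E) :=
    ((hψ.continuous.comp (hX.continuous_y n t)).mul
      (hχs n).continuous).integrable_of_hasCompactSupport (hχc n).mul_left
  have i2 : Integrable (fun x => ψ (hX.y n t x)) (μ 0 : Measure E) :=
    Integrable.of_bound (hψ.continuous.comp (hX.continuous_y n t)).aestronglyMeasurable Ψ
      (Eventually.of_forall fun x => hΨ _)
  simp only [mul_sub, mul_one]
  rw [integral_sub i2 i1]
  ring

/-- The images of the initial measure under the truncated flows converge narrowly to the weak
solution. -/
theorem tendsto_map_y (hX : Exhaustion v w g) (h : WeakSolution v μ) {t : ℝ} (ht : 0 ≤ t) :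
    Tendsto (fun n => (μ 0).map (hX.continuous_y n t).aemeasurable) atTop (𝓝 (μ t)) := by
  rw [tendsto_iff_forall_lipschitz_integral_tendsto]
  rintro ψ ⟨C, hC⟩ ⟨K, hK⟩
  have hb : ∀ x, |ψ x| ≤ |ψ 0| + C := fun x => by
    have h1 := hC x 0
    rw [Real.dist_eq] at h1
    have h2 := abs_sub_abs_le_abs_sub (ψ x) (ψ 0)
    linarith
  refine (hX.tendsto_integral_comp_y h ht hK hb).congr fun n => ?_
  rw [ProbabilityMeasure.toMeasure_map, integral_map (hX.continuous_y n t).aemeasurable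
    hK.continuous.aestronglyMeasurable]

/-- The set of points that the `n`-th truncated flow keeps in the ball of radius `n + 1` during the
time interval `[0, t]`, which is written as `[0, 1] * t`. -/
def stay (hX : Exhaustion v w g) (n : ℕ) (t : ℝ) : Set E :=
  {x | ∀ q ∈ Icc (0 : ℝ) 1, ‖hX.y n (q * t) x‖ ≤ n + 1}

theorem mem_stay_iff (hX : Exhaustion v w g) {n : ℕ} {t : ℝ} (ht : 0 ≤ t) {x : E} :
    x ∈ hX.stay n t ↔ ∀ r ∈ Icc 0 t, ‖hX.y n r x‖ ≤ n + 1 := by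
  refine ⟨fun hx r hr => ?_, fun hx q hq =>
    hx _ ⟨mul_nonneg hq.1 ht, mul_le_of_le_one_left ht hq.2⟩⟩
  rcases ht.eq_or_lt with rfl | ht
  · have := hx 0 ⟨le_rfl, zero_le_one⟩
    rwa [zero_mul, ← le_antisymm hr.2 hr.1] at this
  · have := hx (r / t) ⟨div_nonneg hr.1 ht.le, (div_le_one ht).mpr hr.2⟩
    rwa [div_mul_cancel₀ _ ht.ne'] at this

theorem isClosed_stayGraph (hX : Exhaustion v w g) (n : ℕ) :
    IsClosed {p : ℝ × E | p.2 ∈ hX.stay n p.1} := by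
  have : {p : ℝ × E | p.2 ∈ hX.stay n p.1} =
      ⋂ q ∈ Icc (0 : ℝ) 1, {p : ℝ × E | ‖hX.y n (q * p.1) p.2‖ ≤ n + 1} := by
    ext p
    simp [stay]
  rw [this]
  exact isClosed_biInter fun q _ => isClosed_le
    ((hX.continuous_uncurry_y n).comp (by fun_prop :
      Continuous fun p : ℝ × E => (q * p.1, p.2))).norm continuous_const

theorem isClosed_stay (hX : Exhaustion v w g) (n : ℕ) (t : ℝ) : IsClosed (hX.stay n t) :=
  (hX.isClosed_stayGraph n).preimage (continuous_const.prodMk continuous_id : Continuous (t, ·))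

theorem integral_congr_of_norm_le (hX : Exhaustion v w g) {n : ℕ} {t : ℝ} (ht : t ≤ n)
    {γ : ℝ → E} (hb : ∀ r ∈ Icc 0 t, ‖γ r‖ ≤ n + 1) {r : ℝ} (hr : r ∈ Icc 0 t) :
    ∫ q in (0 : ℝ)..r, w n q (γ q) = ∫ q in (0 : ℝ)..r, v q (γ q) := by
  refine intervalIntegral.integral_congr_ae ?_
  filter_upwards [hX.eq n] with q hq hqr
  rw [uIoc_of_le hr.1] at hqr
  refine hq ⟨hqr.1.le, hqr.2.trans (hr.2.trans ht)⟩ _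
    ((hb q ⟨hqr.1.le, hqr.2.trans hr.2⟩).trans ?_)
  linarith [(Nat.cast_nonneg n : (0 : ℝ) ≤ n)]

theorem eq_y_of_norm_le (hX : Exhaustion v w g) {n : ℕ} {t : ℝ} (ht : t ≤ n)
    {γ : ℝ → E} {x : E} (hγ : ContinuousOn γ (Icc 0 t))
    (h : ∀ r ∈ Icc 0 t, γ r = x + ∫ q in (0 : ℝ)..r, v q (γ q))
    (hb : ∀ r ∈ Icc 0 t, ‖γ r‖ ≤ n + 1) {r : ℝ} (hr : r ∈ Icc 0 t) : γ r = hX.y n r x := by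
  refine (hX.lipField n).eq_flow hr.1 (hγ.mono (Icc_subset_Icc_right hr.2)) fun q hq => ?_
  have hq' : q ∈ Icc 0 t := ⟨hq.1, hq.2.trans hr.2⟩
  rw [hX.integral_congr_of_norm_le ht hb hq', h q hq']

theorem y_eq_of_mem_stay (hX : Exhaustion v w g) {n : ℕ} {t : ℝ} (ht : t ≤ n) {x : E}
    (hx : x ∈ hX.stay n t) {r : ℝ} (hr : r ∈ Icc 0 t) :
    hX.y n r x = x + ∫ q in (0 : ℝ)..r, v q (hX.y n q x) := by
  have hb := (hX.mem_stay_iff (hr.1.trans hr.2)).mp hx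
  rw [← hX.integral_congr_of_norm_le ht hb hr]
  exact (hX.lipField n).flow_eq hr.1 x

theorem y_eq_y_of_mem_stay (hX : Exhaustion v w g) {n k : ℕ} (hnk : n ≤ k) {t : ℝ} (ht : t ≤ n)
    {x : E} (hx : x ∈ hX.stay n t) {r : ℝ} (hr : r ∈ Icc 0 t) : hX.y k r x = hX.y n r x := by
  have hb := (hX.mem_stay_iff (hr.1.trans hr.2)).mp hx
  have hnk' : (n : ℝ) ≤ k := by exact_mod_cast hnk
  exact (hX.eq_y_of_norm_le (ht.trans hnk') (hX.continuous_y_left n x).continuousOn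
    (fun q hq => hX.y_eq_of_mem_stay ht hx hq)
    (fun q hq => (hb q hq).trans (by linarith)) hr).symm

/-- The mass that has not left the ball of radius `n + 1` is transported below the weak solution. -/
theorem map_restrict_stay_le (hX : Exhaustion v w g) (h : WeakSolution v μ) {n : ℕ} {t : ℝ}
    (ht : 0 ≤ t) (htn : t ≤ n) :
    ((μ 0 : Measure E).restrict (hX.stay n t)).map (hX.y n t) ≤ (μ t : Measure E) := by
  have hm : ∀ k, Measurable (hX.y k t) := fun k => (hX.continuous_y k t).measurable
  have hclosed : ∀ F, IsClosed F →
      ((μ 0 : Measure E).restrict (hX.stay n t)).map (hX.y n t) F ≤ (μ t : Measure E) F := by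
    intro F hF
    refine le_trans ?_ (ProbabilityMeasure.limsup_measure_closed_le_of_tendsto
      (hX.tendsto_map_y h ht) hF)
    refine le_limsup_of_frequently_le' (Eventually.frequently ?_)
    filter_upwards [eventually_ge_atTop n] with k hk
    rw [ProbabilityMeasure.toMeasure_map, Measure.map_apply (hm n) hF.measurableSet,
      Measure.map_apply (hm k) hF.measurableSet,
      Measure.restrict_apply ((hm n) hF.measurableSet)]
    refine measure_mono fun x hx => ?_
    rw [mem_preimage, hX.y_eq_y_of_mem_stay hk htn hx.2 ⟨ht, le_rfl⟩]
    exact hx.1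
  refine Measure.le_iff.mpr fun A hA => ?_
  rw [hA.measure_eq_iSup_isClosed_of_ne_top (measure_ne_top _ _)]
  exact iSup₂_le fun F hFA => iSup_le fun hF => (hclosed F hF).trans (measure_mono hFA)

/-- The speed at time `r` along the truncated trajectory of `x`, until this trajectory leaves the
ball of radius `n + 1`. -/
noncomputable def staySpeed (hX : Exhaustion v w g) (n : ℕ) (r : ℝ) (x : E) : ENNReal :=
  {p : ℝ × E | p.2 ∈ hX.stay n p.1}.indicator (fun p => ‖v p.1 (hX.y n p.1 p.2)‖ₑ) (r, x)

theorem staySpeed_of_mem (hX : Exhaustion v w g) {n : ℕ} {r : ℝ} {x : E}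
    (hx : x ∈ hX.stay n r) : hX.staySpeed n r x = ‖v r (hX.y n r x)‖ₑ :=
  indicator_of_mem (s := {p : ℝ × E | p.2 ∈ hX.stay n p.1}) hx _

theorem measurable_staySpeed (hX : Exhaustion v w g)
    (hv : Measurable fun p : ℝ × E => v p.1 p.2) (n : ℕ) :
    Measurable fun p : ℝ × E => hX.staySpeed n p.1 p.2 :=
  (hv.comp (measurable_fst.prodMk (hX.continuous_uncurry_y n).measurable)).enorm.indicator
    (hX.isClosed_stayGraph n).measurableSet

theorem lintegral_staySpeed_le (hX : Exhaustion v w g) (h : WeakSolution v μ) {n : ℕ} {r : ℝ}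
    (hr : 0 ≤ r) (hrn : r ≤ n) :
    ∫⁻ x, hX.staySpeed n r x ∂(μ 0 : Measure E) ≤ ∫⁻ x, ‖v r x‖ₑ ∂(μ r : Measure E) := by
  have h1 : (fun x => hX.staySpeed n r x) =
      (hX.stay n r).indicator fun x => ‖v r (hX.y n r x)‖ₑ := rfl
  have hvr : Measurable fun x => ‖v r x‖ₑ := (h.measurable.comp measurable_prodMk_left).enorm
  rw [h1, lintegral_indicator (hX.isClosed_stay n r).measurableSet,
    ← lintegral_map hvr (hX.continuous_y n r).measurable]
  exact lintegral_mono' (hX.map_restrict_stay_le h hr hrn) le_rfl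

/-- A trajectory that leaves the ball of radius `n + 1` has to travel from `x` to its boundary. -/
theorem le_lintegral_staySpeed (hX : Exhaustion v w g) {n : ℕ} {T : ℝ} (hT : 0 ≤ T) (hTn : T ≤ n)
    {x : E} (hx : x ∉ hX.stay n T) :
    ENNReal.ofReal ((n + 1 : ℝ) - ‖x‖) ≤ ∫⁻ r in Icc 0 T, hX.staySpeed n r x := by
  rcases le_or_gt ((n + 1 : ℝ) - ‖x‖) 0 with hxn | hxn
  · rw [ENNReal.ofReal_of_nonpos hxn]; exact zero_le
  have hc := (hX.continuous_y_left n x).norm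
  set Z := Icc 0 T ∩ {r | (n + 1 : ℝ) ≤ ‖hX.y n r x‖} with hZ
  have hZc : IsCompact Z := isCompact_Icc.inter_right (isClosed_le continuous_const hc)
  have hZne : Z.Nonempty := by
    rw [hX.mem_stay_iff hT] at hx
    push Not at hx
    obtain ⟨r, hr, hr'⟩ := hx
    exact ⟨r, hr, hr'.le⟩
  -- `r₁` is the exit time.
  obtain ⟨r₁, hr₁, hmin⟩ := hZc.exists_isLeast hZne
  have hstay : ∀ r ∈ Ico 0 r₁, x ∈ hX.stay n r := fun r hr => by
    rw [hX.mem_stay_iff hr.1]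
    intro q hq
    by_contra hcon
    have h1 : q < r₁ := lt_of_le_of_lt hq.2 hr.2
    exact not_le.mpr h1 (hmin ⟨⟨hq.1, h1.le.trans hr₁.1.2⟩, (not_le.mp hcon).le⟩)
  have hflow : hX.y n r₁ x - x = ∫ q in (0 : ℝ)..r₁, w n q (hX.y n q x) := by
    rw [sub_eq_iff_eq_add']
    exact (hX.lipField n).flow_eq hr₁.1.1 x
  calc ENNReal.ofReal ((n + 1 : ℝ) - ‖x‖) ≤ ENNReal.ofReal ‖hX.y n r₁ x - x‖ := by
        refine ENNReal.ofReal_le_ofReal ?_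
        have h1 : (n + 1 : ℝ) ≤ ‖hX.y n r₁ x‖ := hr₁.2
        have h2 := norm_sub_norm_le (hX.y n r₁ x) x
        linarith
    _ = ‖∫ q in Ioc 0 r₁, w n q (hX.y n q x)‖ₑ := by
        rw [hflow, ofReal_norm, intervalIntegral.integral_of_le hr₁.1.1]
    _ ≤ ∫⁻ q in Ioc 0 r₁, ‖w n q (hX.y n q x)‖ₑ := enorm_integral_le_lintegral_enorm _
    _ = ∫⁻ q in Ioc 0 r₁, hX.staySpeed n q x := by
        refine setLIntegral_congr_fun_ae measurableSet_Ioc ?_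
        have hne : ∀ᵐ q : ℝ, q ≠ r₁ := by simp [ae_iff]
        filter_upwards [hX.eq n, hne] with q hq hqr hq0
        have hq' : q ∈ Ico 0 r₁ := ⟨hq0.1.le, lt_of_le_of_ne hq0.2 hqr⟩
        have hs := hstay q hq'
        rw [hX.staySpeed_of_mem hs, hq ⟨hq0.1.le, hq0.2.trans (hr₁.1.2.trans hTn)⟩]
        refine ((hX.mem_stay_iff hq'.1).mp hs q ⟨hq'.1, le_rfl⟩).trans ?_
        linarith [(Nat.cast_nonneg n : (0 : ℝ) ≤ n)]
    _ ≤ ∫⁻ r in Icc 0 T, hX.staySpeed n r x :=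
        lintegral_mono_set (Ioc_subset_Icc_self.trans (Icc_subset_Icc_right hr₁.1.2))

/-- Almost every trajectory stays in some ball up to time `T`: the expected length of the
trajectories until they leave the ball of radius `n + 1` is bounded independently of `n`, by Fatou's
lemma. -/
theorem ae_exists_mem_stay (hX : Exhaustion v w g) (h : WeakSolution v μ) (T : ℕ) :
    ∀ᵐ x ∂(μ 0 : Measure E), ∃ n, T ≤ n ∧ x ∈ hX.stay n T := by
  set F : ℕ → E → ENNReal := fun n x => ∫⁻ r in Icc (0 : ℝ) T, hX.staySpeed (n + T) r x with hF
  have hFm : ∀ n, Measurable (F n) := fun n =>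
    ((hX.measurable_staySpeed h.measurable (n + T)).comp measurable_swap).lintegral_prod_right'
  have hFle : ∀ n, ∫⁻ x, F n x ∂(μ 0 : Measure E) ≤
      ∫⁻ t in Icc (0 : ℝ) T, ∫⁻ x, ‖v t x‖ₑ ∂(μ t : Measure E) := fun n => by
    refine (lintegral_lintegral_swap (f := fun x r => hX.staySpeed (n + T) r x)
      ((hX.measurable_staySpeed h.measurable (n + T)).comp
        measurable_swap).aemeasurable).trans_le ?_
    refine setLIntegral_mono' measurableSet_Icc fun r hr =>
      hX.lintegral_staySpeed_le h hr.1 (hr.2.trans ?_)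
    push_cast
    linarith [(Nat.cast_nonneg n : (0 : ℝ) ≤ n)]
  have hfin : ∫⁻ x, liminf (fun n => F n x) atTop ∂(μ 0 : Measure E) < ⊤ := by
    refine lt_of_le_of_lt (lintegral_liminf_le hFm) (lt_of_le_of_lt ?_ (h.lintegral_lt_top T))
    exact liminf_le_of_le (by isBoundedDefault) fun b hb => by
      obtain ⟨n, hn⟩ := hb.exists
      exact hn.trans (hFle n)
  filter_upwards [ae_lt_top (Measurable.liminf hFm) hfin.ne] with x hx
  by_contra hcon
  push Not at hcon
  have hle : ∀ n : ℕ, ENNReal.ofReal (((n + T : ℕ) + 1 : ℝ) - ‖x‖) ≤ F n x := fun n =>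
    hX.le_lintegral_staySpeed T.cast_nonneg (by exact_mod_cast Nat.le_add_left T n)
      (hcon (n + T) (Nat.le_add_left T n))
  have htop : Tendsto (fun n => F n x) atTop (𝓝 ⊤) := by
    refine tendsto_nhds_top_mono' (f := fun n : ℕ =>
      ENNReal.ofReal (((n + T : ℕ) + 1 : ℝ) - ‖x‖)) ?_ hle
    refine ENNReal.tendsto_ofReal_atTop.comp ?_
    have h1 : Tendsto (fun n : ℕ => (n : ℝ)) atTop atTop := tendsto_natCast_atTop_atTop
    refine tendsto_atTop_mono (fun n => ?_) (tendsto_atTop_add_const_right atTop (-‖x‖) h1)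
    push_cast
    linarith [(Nat.cast_nonneg T : (0 : ℝ) ≤ T)]
  rw [htop.liminf_eq] at hx
  exact lt_irrefl _ hx

end Exhaustion
end Exhaustion

/-! ### The limit flow -/

section LimitFlow

variable {m : ℕ} {v : ℝ → EuclideanSpace ℝ (Fin m) → EuclideanSpace ℝ (Fin m)}
  {w : ℕ → ℝ → EuclideanSpace ℝ (Fin m) → EuclideanSpace ℝ (Fin m)} {g : ℕ → ℝ → ℝ}
  {μ : ℝ → ProbabilityMeasure (EuclideanSpace ℝ (Fin m))}

/-- Solutions of the continuity equation on `[0, ∞)`, extended constantly to negative times. -/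
theorem weakSolution_of_isContinuityEqSolution {μ₀ : ProbabilityMeasure (EuclideanSpace ℝ (Fin m))}
    (hv : Measurable (fun p : ℝ × EuclideanSpace ℝ (Fin m) => v p.1 p.2))
    (hint : HasLocIntegrableL1Norm v μ)
    (hsol : IsContinuityEqSolution v μ₀ μ) : WeakSolution v fun t => μ (max t 0) where
  measurable := hv
  continuous := hsol.continuousOn.comp_continuous (continuous_id.max continuous_const)
    fun t => le_max_right t 0
  lintegral_lt_top T := by
    refine lt_of_le_of_lt (le_of_eq ?_) (hint T)
    refine setLIntegral_congr_fun measurableSet_Icc fun t ht => ?_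
    simp only [max_eq_left ht.1, eLpNorm_one_eq_lintegral_enorm]
  weak φ h1 h2 h3 := by
    refine Eq.trans ?_ (hsol.weak φ h1 h2 h3)
    refine setIntegral_congr_fun measurableSet_Ioi fun t ht => ?_
    simp only [max_eq_left (mem_Ioi.mp ht).le]

theorem exists_exhaustion (hv : Measurable (fun p : ℝ × EuclideanSpace ℝ (Fin m) => v p.1 p.2))
    (hLip : HasLocLipBounds v) : ∃ w g, Exhaustion v w g := by
  have key : ∀ n : ℕ, ∃ w : ℝ → EuclideanSpace ℝ (Fin m) → EuclideanSpace ℝ (Fin m),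
      ∃ g : ℝ → ℝ, LipField w g ∧ ∀ᵐ t, t ∈ Icc (0 : ℝ) n →
        ∀ x, ‖x‖ ≤ 2 * ((n : ℝ) + 1) → w t x = v t x := fun n => by
    obtain ⟨B, L, hBL, h⟩ := hLip (Metric.closedBall 0 (2 * (2 * ((n : ℝ) + 1))))
      (isCompact_closedBall _ _)
    exact exists_lipField_eq hv (by positivity) n hBL h
  choose w g hw he using key
  exact ⟨w, g, hw, he⟩

namespace Exhaustion

/-- The pointwise limit of the truncated flows, which are eventually constant along almost every
trajectory. -/
noncomputable def limitFlow (hX : Exhaustion v w g) (t : ℝ) (x : EuclideanSpace ℝ (Fin m)) :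
    EuclideanSpace ℝ (Fin m) :=
  limUnder atTop fun n => hX.y n t x

theorem limitFlow_eq (hX : Exhaustion v w g) {n : ℕ} {T : ℝ} (hTn : T ≤ n)
    {x : EuclideanSpace ℝ (Fin m)} (hx : x ∈ hX.stay n T) {t : ℝ} (ht : t ∈ Icc 0 T) :
    Tendsto (fun k => hX.y k t x) atTop (𝓝 (hX.y n t x)) ∧ hX.limitFlow t x = hX.y n t x := by
  have h : Tendsto (fun k => hX.y k t x) atTop (𝓝 (hX.y n t x)) := by
    refine tendsto_const_nhds.congr' ?_
    filter_upwards [eventually_ge_atTop n] with k hk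
    exact (hX.y_eq_y_of_mem_stay hk hTn hx ht).symm
  exact ⟨h, h.limUnder_eq⟩

theorem isODESolution_limitFlow (hX : Exhaustion v w g) {x : EuclideanSpace ℝ (Fin m)}
    (hx : ∀ T : ℕ, ∃ n, T ≤ n ∧ x ∈ hX.stay n T) :
    IsODESolution v x fun t => hX.limitFlow t x where
  initial := by
    obtain ⟨n, hn, hxn⟩ := hx 0
    rw [(hX.limitFlow_eq (by simp) hxn ⟨le_rfl, by simp⟩).2, hX.y_zero]
  absCont T hT := by
    obtain ⟨N, hN⟩ := exists_nat_ge T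
    obtain ⟨n, hn, hxn⟩ := hx N
    refine absolutelyContinuousOnInterval_of_dist_le (K := 1)
      ((hX.lipField n).absolutelyContinuousOnInterval_flow hT x) fun a ha b hb => ?_
    rw [uIcc_of_le hT] at ha hb
    have hNn : (N : ℝ) ≤ n := by exact_mod_cast hn
    rw [(hX.limitFlow_eq hNn hxn ⟨ha.1, ha.2.trans hN⟩).2,
      (hX.limitFlow_eq hNn hxn ⟨hb.1, hb.2.trans hN⟩).2, one_mul]
    rfl
  hasDerivAt := by
    rw [ae_restrict_iff' measurableSet_Ioi]
    have key : ∀ N : ℕ, ∀ᵐ t : ℝ, t ∈ Ioo (0 : ℝ) N →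
        HasDerivAt (fun t => hX.limitFlow t x) (v t (hX.limitFlow t x)) t := fun N => by
      obtain ⟨n, hn, hxn⟩ := hx N
      have hNn : (N : ℝ) ≤ n := by exact_mod_cast hn
      filter_upwards [(hX.lipField n).ae_hasDerivAt_flow 0 x, hX.eq n] with t h1 h2 ht
      have ht' : t ∈ Icc (0 : ℝ) N := ⟨ht.1.le, ht.2.le⟩
      have h3 : HasDerivAt (fun r => hX.y n r x) (w n t (hX.y n t x)) t := h1 ht.1
      have hb := (hX.mem_stay_iff N.cast_nonneg).mp hxn t ht'
      rw [h2 ⟨ht'.1, ht'.2.trans hNn⟩ _ (hb.trans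
        (by linarith [(Nat.cast_nonneg n : (0 : ℝ) ≤ n)]))] at h3
      rw [(hX.limitFlow_eq hNn hxn ht').2]
      refine h3.congr_of_eventuallyEq ?_
      filter_upwards [Ioo_mem_nhds ht.1 ht.2] with r hr
      exact (hX.limitFlow_eq hNn hxn ⟨hr.1.le, hr.2.le⟩).2
    filter_upwards [ae_all_iff.mpr key] with t ht ht0
    obtain ⟨N, hN⟩ := exists_nat_gt t
    exact ht N ⟨ht0, hN⟩

/-- A solution is bounded up to time `t`, so it is an integral curve of all the truncated fields
with a large index. -/
theorem eq_limitFlow_of_isODESolution (hX : Exhaustion v w g)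
    {x : EuclideanSpace ℝ (Fin m)} {γ : ℝ → EuclideanSpace ℝ (Fin m)}
    (hγ : IsODESolution v x γ) {t : ℝ} (ht : 0 ≤ t) : γ t = hX.limitFlow t x := by
  have hac := hγ.absCont t ht
  have hc : ContinuousOn γ (Icc 0 t) := by
    rw [← uIcc_of_le ht]; exact hac.continuousOn
  obtain ⟨C, hC⟩ := isCompact_Icc.exists_bound_of_continuousOn hc
  obtain ⟨N, hN⟩ := exists_nat_ge (max C t)
  have key : ∀ n, N ≤ n → γ t = hX.y n t x := fun n hn => by
    have hNn : (N : ℝ) ≤ n := by exact_mod_cast hn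
    have htn : t ≤ n := (le_max_right C t).trans (hN.trans hNn)
    have hCn : C ≤ n := (le_max_left C t).trans (hN.trans hNn)
    have hb : ∀ r ∈ Icc 0 t, ‖γ r‖ ≤ 2 * ((n : ℝ) + 1) := fun r hr =>
      (hC r hr).trans (by linarith [(Nat.cast_nonneg n : (0 : ℝ) ≤ n)])
    have hd := (ae_restrict_iff' measurableSet_Ioi).mp hγ.hasDerivAt
    have h1 := (hX.lipField n).eq_add_integral_of_ae_hasDerivAt ht hac (by
      filter_upwards [hd, hX.eq n] with r h1 h2 hr
      rw [h2 ⟨hr.1.le, hr.2.le.trans htn⟩ _ (hb r ⟨hr.1.le, hr.2.le⟩)]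
      exact h1 hr.1)
    rw [hγ.initial] at h1
    exact (hX.lipField n).eq_flow ht hc h1
  have h : Tendsto (fun n => hX.y n t x) atTop (𝓝 (γ t)) := by
    refine tendsto_const_nhds.congr' ?_
    filter_upwards [eventually_ge_atTop N] with n hn
    exact key n hn
  exact h.limUnder_eq.symm

theorem ae_tendsto_limitFlow (hX : Exhaustion v w g) (h : WeakSolution v μ) {t : ℝ} (ht : 0 ≤ t) :
    ∀ᵐ x ∂(μ 0 : Measure (EuclideanSpace ℝ (Fin m))),
      Tendsto (fun n => hX.y n t x) atTop (𝓝 (hX.limitFlow t x)) := by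
  obtain ⟨N, hN⟩ := exists_nat_ge t
  filter_upwards [hX.ae_exists_mem_stay h N] with x hx
  obtain ⟨n, hn, hxn⟩ := hx
  have := hX.limitFlow_eq (by exact_mod_cast hn) hxn ⟨ht, hN⟩
  rw [this.2]
  exact this.1

theorem aemeasurable_limitFlow (hX : Exhaustion v w g) (h : WeakSolution v μ) {t : ℝ}
    (ht : 0 ≤ t) : AEMeasurable (hX.limitFlow t) (μ 0 : Measure (EuclideanSpace ℝ (Fin m))) :=
  aemeasurable_of_tendsto_metrizable_ae atTop
    (fun n => (hX.continuous_y n t).aemeasurable) (hX.ae_tendsto_limitFlow h ht)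

theorem map_limitFlow_eq (hX : Exhaustion v w g) (h : WeakSolution v μ) {t : ℝ} (ht : 0 ≤ t) :
    (μ t : Measure (EuclideanSpace ℝ (Fin m))) =
      (μ 0 : Measure (EuclideanSpace ℝ (Fin m))).map (hX.limitFlow t) := by
  have hm := hX.aemeasurable_limitFlow h ht
  have hlim : Tendsto (fun n => (μ 0).map (hX.continuous_y n t).aemeasurable) atTop
      (𝓝 ((μ 0).map hm)) := by
    rw [ProbabilityMeasure.tendsto_iff_forall_integral_tendsto]
    intro f
    simp only [ProbabilityMeasure.toMeasure_map]
    rw [integral_map hm f.continuous.aestronglyMeasurable]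
    simp only [integral_map (hX.continuous_y _ t).aemeasurable f.continuous.aestronglyMeasurable]
    refine tendsto_integral_of_dominated_convergence (fun _ => ‖f‖)
      (fun n => (f.continuous.comp (hX.continuous_y n t)).aestronglyMeasurable)
      (integrable_const _) (fun n => Eventually.of_forall fun x => f.norm_coe_le_norm _) ?_
    filter_upwards [hX.ae_tendsto_limitFlow h ht] with x hx
    exact (f.continuous.tendsto _).comp hx
  rw [tendsto_nhds_unique (hX.tendsto_map_y h ht) hlim, ProbabilityMeasure.toMeasure_map]

end Exhaustion

end LimitFlow

end ContinuityEq

theorem mainTheorem4 {m : ℕ}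
    (v : ℝ → EuclideanSpace ℝ (Fin m) → EuclideanSpace ℝ (Fin m))
    (hv : Measurable (fun p : ℝ × EuclideanSpace ℝ (Fin m) => v p.1 p.2))
    (hLip : HasLocLipBounds v)
    (μ₀ : ProbabilityMeasure (EuclideanSpace ℝ (Fin m)))
    (μ : ℝ → ProbabilityMeasure (EuclideanSpace ℝ (Fin m)))
    (hint : HasLocIntegrableL1Norm v μ)
    (hsol : IsContinuityEqSolution v μ₀ μ) :
    ∃ X : ℝ → EuclideanSpace ℝ (Fin m) → EuclideanSpace ℝ (Fin m),
      IsFlow v μ₀ X ∧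
      ∀ t : ℝ, 0 ≤ t →
        AEMeasurable (X t) (μ₀ : Measure (EuclideanSpace ℝ (Fin m))) ∧
        (μ t : Measure (EuclideanSpace ℝ (Fin m))) =
          (μ₀ : Measure (EuclideanSpace ℝ (Fin m))).map (X t) := by
  have h := ContinuityEq.weakSolution_of_isContinuityEqSolution hv hint hsol
  obtain ⟨w, g, hX⟩ := ContinuityEq.exists_exhaustion hv hLip
  have h0 : μ (max 0 0) = μ₀ := by rw [max_self, hsol.initial]
  refine ⟨hX.limitFlow, ?_, fun t ht => ⟨?_, ?_⟩⟩
  · have hae := ae_all_iff.mpr fun T : ℕ => hX.ae_exists_mem_stay h T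
    rw [h0] at hae
    filter_upwards [hae] with x hx
    exact ⟨hX.isODESolution_limitFlow hx,
      fun γ hγ t ht => hX.eq_limitFlow_of_isODESolution hγ ht⟩
  · have := hX.aemeasurable_limitFlow h ht
    rwa [h0] at this
  · have := hX.map_limitFlow_eq h ht
    rwa [h0, max_eq_left ht] at this
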